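/- For $n,k\in\mathbb{N}$ let $C_n^k$ be the cardinality constraint $\sum_{i=1}^n x_i\le k$ in the Boolean variables $x_1,\dots,x_n$. A clausal encoding of a Boolean function $f$ in variables $X$ is a CNF-formula $F$ on a variable set $X\cup Y$, with $Y$ a finite set of auxiliary variables, such that an assignment to $X$ can be extended to a model of $F$ if and only if it satisfies $f$. The primal graph of $F$ has the variables as vertices, two being adjacent if they occur in a common clause; the dual graph has the clauses as vertices, two being adjacent if they share a variable; the incidence graph has the variables and the clauses as vertices, a variable being adjacent to the clauses in which it occurs; the signed incidence graph moreover labels these edges by $+$ or $-$ according to the sign of the occurrence. Primal, dual and incidence treewidth are the treewidths of the first three graphs, incidence cliquewidth and MIM-width are the cliquewidth and MIM-width of the incidence graph, signed incidence cliquewidth is the signed cliquewidth of the signed incidence graph, and modular treewidth is the treewidth of the graph obtained from the incidence graph by contracting each class of vertices $u,v$ with $N(u)\setminus\{v\}=N(v)\setminus\{u\}$ to one vertex. (1) Let $\mu$ be one of primal treewidth, dual treewidth, incidence treewidth, signed incidence cliquewidth. There are constants $c_1,c_2>0$ such that for all $n,k\in\mathbb{N}$ with $k\le n$ and $s:=\min(k,n-k)\ge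 2$, clausal encodings of $C_n^k$ of smallest $\mu$-width exist, and every such encoding $F$ satisfies \[ c_1\log_2 s\;\le\;\mu(F)\;\le\;c_2\log_2 s .\] (2) There is a constant $c$ such that for all $n,k\in\mathbb{N}$ there is a clausal encoding of $C_n^k$ whose incidence cliquewidth, modular treewidth and MIM-width are all at most $c$. -/

import Mathlib

noncomputable section

/-! ### CNF-formulas and clausal encodings -/

/-- A literal: `(x, true)` is the literal `x`, and `(x, false)` is the literal `¬x`. -/
abbrev Lit (V : Type) : Type := V × Bool

/-- A clause is a finite set of literals. -/
abbrev Clause (V : Type) : Type := Finset (Lit V)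

/-- A CNF-formula on the variable set `V` is a finite set of clauses. -/
abbrev CNFFormula (V : Type) : Type := Finset (Clause V)

/-- The clause `C` contains a literal in the variable `x`. -/
def Clause.HasVar {V : Type} (C : Clause V) (x : V) : Prop := ∃ b : Bool, (x, b) ∈ C

/-- The assignment `a` is a model of `F`. -/
def CNFFormula.IsModel {V : Type} (F : CNFFormula V) (a : V → Bool) : Prop :=
  ∀ C ∈ F, ∃ l ∈ C, a l.1 = l.2

/-- `F`, on the variables `X` together with the auxiliary variables `Y`, is a clausal encoding of
the Boolean function `f` on `X`: an assignment to `X` extends to a model of `F` if and only if `f`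
evaluates to true on it. -/
def IsClausalEncoding {X Y : Type} (F : CNFFormula (X ⊕ Y)) (f : (X → Bool) → Bool) : Prop :=
  ∀ a : X → Bool, f a = true ↔ ∃ b : Y → Bool, F.IsModel (Sum.elim a b)

/-- The cardinality constraint `∑ x_i ≤ k` in `n` Boolean variables. -/
def cardinalityConstraint (n k : ℕ) : (Fin n → Bool) → Bool :=
  fun a => decide (∑ i, (a i).toNat ≤ k)

/-! ### Graphs of a CNF-formula -/

/-- Vertices: the variables. Two variables are adjacent if some clause contains both. -/
def primalGraph {V : Type} (F : CNFFormula V) : SimpleGraph V :=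
  SimpleGraph.fromRel fun x y => ∃ C ∈ F, Clause.HasVar C x ∧ Clause.HasVar C y

/-- Vertices: the clauses. Two clauses are adjacent if they have a variable in common. -/
def dualGraph {V : Type} (F : CNFFormula V) : SimpleGraph {C // C ∈ F} :=
  SimpleGraph.fromRel fun C D => ∃ x, Clause.HasVar C.1 x ∧ Clause.HasVar D.1 x

/-- Vertices: the variables and the clauses. A variable is adjacent to the clauses that contain a
literal in it. -/
def incidenceGraph {V : Type} (F : CNFFormula V) : SimpleGraph (V ⊕ {C // C ∈ F}) :=
  SimpleGraph.fromRel fun u v => ∃ x C, u = Sum.inl x ∧ v = Sum.inr C ∧ Clause.HasVar C.1 x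

/-- The edges of the incidence graph with a given sign (`true` for `+`, `false` for `-`):
`x` and `C` are joined by an edge of sign `b` if `(x, b)` is a literal of `C`. -/
def signedIncidenceGraph {V : Type} (F : CNFFormula V) (b : Bool) :
    SimpleGraph (V ⊕ {C // C ∈ F}) :=
  SimpleGraph.fromRel fun u v => ∃ x C, u = Sum.inl x ∧ v = Sum.inr C ∧ (x, b) ∈ C.1

/-! ### Treewidth -/

/-- A tree decomposition of `G`, with the finite tree `tree` on the nodes `ι`. -/
structure TreeDecomposition {V : Type} (G : SimpleGraph V) (ι : Type) where
  tree : SimpleGraph ι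
  isTree : tree.IsTree
  bag : ι → Finset V
  cover : ∀ v, ∃ t, v ∈ bag t
  edge : ∀ u v, G.Adj u v → ∃ t, u ∈ bag t ∧ v ∈ bag t
  connected : ∀ v, (tree.induce {t | v ∈ bag t}).Connected

/-- `G` has a tree decomposition of width at most `w`, where width is the largest size of a bag
minus one. -/
def HasTreewidthLE {V : Type} (G : SimpleGraph V) (w : ℕ) : Prop :=
  ∃ (ι : Type) (_ : Finite ι) (D : TreeDecomposition G ι), ∀ t, (D.bag t).card ≤ w + 1

/-- The treewidth of a finite graph (the graph without vertices gets the value `0`). -/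
def treewidth {V : Type} (G : SimpleGraph V) : ℕ := sInf {w | HasTreewidthLE G w}

/-! ### Modular treewidth -/

/-- `u` and `v` have the same neighborhood type: `N(u) \ {v} = N(v) \ {u}`. -/
def SameNbhdType {V : Type} (G : SimpleGraph V) (u v : V) : Prop :=
  G.neighborSet u \ {v} = G.neighborSet v \ {u}

theorem sameNbhdType_iff {V : Type} (G : SimpleGraph V) (u v : V) :
    SameNbhdType G u v ↔ ∀ w, w ≠ u → w ≠ v → (G.Adj u w ↔ G.Adj v w) := by
  unfold SameNbhdType
  rw [Set.ext_iff]
  constructor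
  · intro h w hu hv
    simpa [hu, hv] using h w
  · intro h w
    by_cases hu : w = u
    · subst hu; simp
    by_cases hv : w = v
    · subst hv; simp
    simpa [hu, hv] using h w hu hv

theorem sameNbhdType_equivalence {V : Type} (G : SimpleGraph V) :
    Equivalence (SameNbhdType G) where
  refl _ := rfl
  symm h := Eq.symm h
  trans := by
    intro a b c hab hbc
    rw [sameNbhdType_iff] at *
    intro w hwa hwc
    by_cases hwb : w = b
    · subst hwb
      by_cases hac : a = c
      · rw [hac]
      have h1 := hab c (Ne.symm hac) (Ne.symm hwc)
      have h2 := hbc a (Ne.symm hwa) hac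
      rw [G.adj_comm a w, h2, G.adj_comm c a, h1, G.adj_comm w c]
    · exact (hab w hwa hwb).trans (hbc w hwb hwc)

/-- The partition of the vertices into neighborhood types. -/
def nbhdTypeSetoid {V : Type} (G : SimpleGraph V) : Setoid V :=
  ⟨SameNbhdType G, sameNbhdType_equivalence G⟩

/-- The graph obtained by contracting every class of vertices with the same neighborhood type. -/
def modularContraction {V : Type} (G : SimpleGraph V) :
    SimpleGraph (Quotient (nbhdTypeSetoid G)) :=
  SimpleGraph.fromRel fun p q =>
    ∃ u v, p = Quotient.mk (nbhdTypeSetoid G) u ∧ q = Quotient.mk (nbhdTypeSetoid G) v ∧ G.Adj u v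

/-- Adjacency of two classes can be read off from any choice of representatives. Hence contracting
the classes is the same as deleting all vertices but one of each class. -/
theorem modularContraction_adj {V : Type} (G : SimpleGraph V) (u v : V) :
    (modularContraction G).Adj (Quotient.mk (nbhdTypeSetoid G) u)
        (Quotient.mk (nbhdTypeSetoid G) v) ↔ ¬ SameNbhdType G u v ∧ G.Adj u v := by
  have key : ∀ u v u' v', SameNbhdType G u u' → SameNbhdType G v v' → ¬ SameNbhdType G u v →
      G.Adj u' v' → G.Adj u v := by
    intro u v u' v' hu hv huv h
    have E := sameNbhdType_equivalence G
    have h1 : v' ≠ u := fun e => huv (E.symm (e ▸ hv))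
    have h2 : u ≠ v := fun e => huv (e ▸ E.refl _)
    have h3 : G.Adj u v' := ((sameNbhdType_iff G u u').1 hu v' h1 h.ne').2 h
    exact (((sameNbhdType_iff G v v').1 hv u h2 h3.ne).2 h3.symm).symm
  have hq : ∀ a b, Quotient.mk (nbhdTypeSetoid G) a = Quotient.mk (nbhdTypeSetoid G) b ↔
      SameNbhdType G a b := fun a b => Quotient.eq (r := nbhdTypeSetoid G)
  unfold modularContraction
  rw [SimpleGraph.fromRel_adj, ne_eq, hq]
  constructor
  · rintro ⟨hne, ⟨u', v', hu, hv, h⟩ | ⟨v', u', hv, hu, h⟩⟩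
    · exact ⟨hne, key u v u' v' ((hq _ _).1 hu) ((hq _ _).1 hv) hne h⟩
    · exact ⟨hne, key u v u' v' ((hq _ _).1 hu) ((hq _ _).1 hv) hne h.symm⟩
  · rintro ⟨hne, h⟩
    exact ⟨hne, Or.inl ⟨u, v, rfl, rfl, h⟩⟩

def modularTreewidth {V : Type} (G : SimpleGraph V) : ℕ := treewidth (modularContraction G)

/-! ### Cliquewidth, unsigned and signed -/

open Classical in
/-- `CWConstructible k lab G` says that the labeled graph with labels in `Fin k` given by `lab` and
`G` can be built by the cliquewidth operations. The vertices of that graph are the `v` with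
`lab v ≠ none`, and `lab v = some i` says that `v` has label `i`. Edges carry a sign in `E`, and
`G e` is the graph of the edges of sign `e`. -/
inductive CWConstructible {V E : Type} (k : ℕ) :
    (V → Option (Fin k)) → (E → SimpleGraph V) → Prop
  /-- creating the vertex `v` with label `i` -/
  | create (v : V) (i : Fin k) :
      CWConstructible k (fun w => if w = v then some i else none) (fun _ => ⊥)
  /-- disjoint union -/
  | union {lab₁ lab₂ : V → Option (Fin k)} {G₁ G₂ : E → SimpleGraph V}
      (h₁ : CWConstructible k lab₁ G₁) (h₂ : CWConstructible k lab₂ G₂)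
      (disj : ∀ v, lab₁ v = none ∨ lab₂ v = none) :
      CWConstructible k (fun v => (lab₁ v).or (lab₂ v)) (fun e => G₁ e ⊔ G₂ e)
  /-- joining all vertices with label `i` to all vertices with label `j` by an edge of sign `s` -/
  | join {lab : V → Option (Fin k)} {G : E → SimpleGraph V} (h : CWConstructible k lab G)
      (s : E) (i j : Fin k) (hij : i ≠ j) :
      CWConstructible k lab (fun e =>
        if e = s then G e ⊔ SimpleGraph.fromRel fun u v => lab u = some i ∧ lab v = some j
        else G e)
  /-- renaming the label `i` to `j` -/
  | rename {lab : V → Option (Fin k)} {G : E → SimpleGraph V} (h : CWConstructible k lab G)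
      (i j : Fin k) (hij : i ≠ j) :
      CWConstructible k (fun v => if lab v = some i then some j else lab v) G

/-- The graph `G`, whose edges carry signs in `E`, can be constructed with `k` labels. -/
def HasCliquewidthLE {V E : Type} (G : E → SimpleGraph V) (k : ℕ) : Prop :=
  ∃ lab : V → Option (Fin k), (∀ v, lab v ≠ none) ∧ CWConstructible k lab G

/-- The cliquewidth of a finite graph (the graph without vertices gets the value `0`). -/
def cliquewidth {V : Type} (G : SimpleGraph V) : ℕ :=
  sInf {k | HasCliquewidthLE (fun _ : Unit => G) k}

/-- The signed cliquewidth of a finite graph whose edges of sign `b` form the graph `G b`. -/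
def signedCliquewidth {V : Type} (G : Bool → SimpleGraph V) : ℕ :=
  sInf {k | HasCliquewidthLE G k}

/-! ### MIM-width -/

/-- Rooted binary trees with leaves labeled by elements of `V`. -/
inductive BranchTree (V : Type) : Type
  | leaf (v : V) : BranchTree V
  | node (l r : BranchTree V) : BranchTree V

/-- The labels of the leaves, from left to right. -/
def BranchTree.leaves {V : Type} : BranchTree V → List V
  | .leaf v => [v]
  | .node l r => l.leaves ++ r.leaves

/-- The subtrees that hang from the nodes of a tree (including the tree itself). -/
def BranchTree.subtrees {V : Type} : BranchTree V → List (BranchTree V)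
  | .leaf v => [.leaf v]
  | .node l r => .node l r :: (l.subtrees ++ r.subtrees)

/-- `M` is an induced matching of the bipartite graph `G[A, V \ A]` formed by the edges of `G`
between `A` and its complement; its edges are given with the endpoint in `A` first. -/
def IsCutInducedMatching {V : Type} (G : SimpleGraph V) (A : Set V) (M : Finset (V × V)) : Prop :=
  (∀ p ∈ M, p.1 ∈ A ∧ p.2 ∉ A ∧ G.Adj p.1 p.2) ∧
    ∀ p ∈ M, ∀ q ∈ M, p ≠ q → p.1 ≠ q.1 ∧ p.2 ≠ q.2 ∧ ¬ G.Adj p.1 q.2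

/-- `T` is a branch decomposition of the vertex set of `G`, i.e. its leaves are in bijection with
the vertices, and for every cut `(A, V \ A)` with `A` the set of leaves below some node of `T`,
induced matchings of `G[A, V \ A]` have at most `w` edges. -/
def IsMimDecomposition {V : Type} (G : SimpleGraph V) (T : BranchTree V) (w : ℕ) : Prop :=
  T.leaves.Nodup ∧ (∀ v, v ∈ T.leaves) ∧
    ∀ S ∈ T.subtrees, ∀ M, IsCutInducedMatching G {v | v ∈ S.leaves} M → M.card ≤ w

/-- The MIM-width of a finite graph (the graph without vertices gets the value `0`). -/
def mimWidth {V : Type} (G : SimpleGraph V) : ℕ := sInf {w | ∃ T, IsMimDecomposition G T w}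

/-! ### The minima above are taken over non-empty sets -/

theorem exists_hasTreewidthLE {V : Type} [Finite V] (G : SimpleGraph V) :
    ∃ w, HasTreewidthLE G w := by
  have := Fintype.ofFinite V
  refine ⟨Fintype.card V, Unit, inferInstance, ⟨⊥, ?_, fun _ => Finset.univ, ?_, ?_, ?_⟩, ?_⟩
  · exact SimpleGraph.IsTree.of_subsingleton
  · simp
  · simp
  · intro v
    have : Nonempty ↑{t : Unit | v ∈ (Finset.univ : Finset V)} := ⟨⟨(), by simp⟩⟩
    exact ⟨fun a b => by rw [Subsingleton.elim a b]⟩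
  · intro t
    simp

theorem exists_hasCliquewidthLE {V E : Type} [Finite V] [Nonempty V] [Finite E]
    (G : E → SimpleGraph V) : ∃ k, HasCliquewidthLE G k := by
  classical
  have := Fintype.ofFinite V
  have := Fintype.ofFinite E
  let e := Fintype.equivFin V
  have h0 : ∀ S : Finset V, S.Nonempty → CWConstructible (E := E) (Fintype.card V)
      (fun v => if v ∈ S then some (e v) else none) (fun _ => ⊥) := by
    intro S hS
    induction hS using Finset.Nonempty.cons_induction with
    | singleton a =>
      convert CWConstructible.create (E := E) a (e a) using 2 with w
      by_cases h : w = a <;> simp [h]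
    | cons a S ha _ ih =>
      convert CWConstructible.union (CWConstructible.create (E := E) a (e a)) ih ?_ using 1
      · funext w
        by_cases h : w = a
        · simp [h]
        · by_cases h' : w ∈ S <;> simp [h, h']
      · funext _; simp
      · intro v
        by_cases h : v = a
        · right; rw [h]; simp [ha]
        · left; simp [h]
  have h1 : CWConstructible (E := E) (Fintype.card V) (fun v => some (e v)) (fun _ => ⊥) := by
    simpa using h0 Finset.univ Finset.univ_nonempty
  have h2 : ∀ S : Finset (E × V × V), (∀ p ∈ S, (G p.1).Adj p.2.1 p.2.2) →
      CWConstructible (E := E) (Fintype.card V) (fun v => some (e v))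
        (fun s => SimpleGraph.fromRel fun u v => (s, u, v) ∈ S) := by
    intro S
    induction S using Finset.induction_on with
    | empty =>
      intro _
      convert h1 using 2 with s
      ext u v; simp
    | insert p S _ ih =>
      intro hp
      have hpp := hp p (Finset.mem_insert_self _ _)
      have := ih fun q hq => hp q (Finset.mem_insert_of_mem hq)
      convert CWConstructible.join this p.1 (e p.2.1) (e p.2.2)
        (fun h => hpp.ne (e.injective h)) using 2 with s
      obtain ⟨s', a, b⟩ := p
      by_cases hs : s = s'
      · subst hs
        ext u v
        simp only [SimpleGraph.fromRel_adj, Finset.mem_insert, Prod.mk.injEq, true_and,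
          if_true, SimpleGraph.sup_adj, Option.some.injEq, e.injective.eq_iff]
        tauto
      · ext u v
        simp [hs]
  refine ⟨Fintype.card V, fun v => some (e v), by simp, ?_⟩
  convert h2 (Finset.univ.filter fun p => (G p.1).Adj p.2.1 p.2.2) (by simp) using 2 with s
  ext u v
  simp only [SimpleGraph.fromRel_adj, Finset.mem_filter, Finset.mem_univ, true_and]
  exact ⟨fun h => ⟨h.ne, Or.inl h⟩, fun h => h.2.elim id fun h => h.symm⟩

theorem exists_isMimDecomposition {V : Type} [Finite V] [Nonempty V] (G : SimpleGraph V) :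
    ∃ w T, IsMimDecomposition G T w := by
  classical
  have := Fintype.ofFinite V
  have h : ∀ S : Finset V, S.Nonempty → ∃ T : BranchTree V,
      T.leaves.Nodup ∧ ∀ v, v ∈ T.leaves ↔ v ∈ S := by
    intro S hS
    induction hS using Finset.Nonempty.cons_induction with
    | singleton a => exact ⟨.leaf a, by simp [BranchTree.leaves], by simp [BranchTree.leaves]⟩
    | cons a S ha _ ih =>
      obtain ⟨T, hT, hm⟩ := ih
      refine ⟨.node (.leaf a) T, ?_, ?_⟩
      · simp [BranchTree.leaves, hT, hm, ha]
      · simp [BranchTree.leaves, hm]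
  obtain ⟨T, hT, hm⟩ := h Finset.univ Finset.univ_nonempty
  exact ⟨Fintype.card (V × V), T, hT, fun v => (hm v).2 (Finset.mem_univ v),
    fun _ _ M _ => Finset.card_le_univ M⟩

/-! ### Width measures of CNF-formulas, and optimal encodings -/

/-- A width measure assigns a number to every CNF-formula. -/
abbrev WidthMeasure : Type 1 := (V : Type) → CNFFormula V → ℕ

def primalTreewidth : WidthMeasure := fun _ F => treewidth (primalGraph F)

def dualTreewidth : WidthMeasure := fun _ F => treewidth (dualGraph F)

def incidenceTreewidth : WidthMeasure := fun _ F => treewidth (incidenceGraph F)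

def signedIncidenceCliquewidth : WidthMeasure :=
  fun _ F => signedCliquewidth (signedIncidenceGraph F)

def incidenceCliquewidth : WidthMeasure := fun _ F => cliquewidth (incidenceGraph F)

def modularIncidenceTreewidth : WidthMeasure := fun _ F => modularTreewidth (incidenceGraph F)

def incidenceMimWidth : WidthMeasure := fun _ F => mimWidth (incidenceGraph F)

/-- `F` is a clausal encoding of `f` of smallest `μ`-width, among all clausal encodings of `f` with
any number of auxiliary variables. -/
def IsOptimalEncoding (μ : WidthMeasure) {n m : ℕ} (F : CNFFormula (Fin n ⊕ Fin m))
    (f : (Fin n → Bool) → Bool) : Prop :=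
  IsClausalEncoding F f ∧
    ∀ (m' : ℕ) (F' : CNFFormula (Fin n ⊕ Fin m')), IsClausalEncoding F' f → μ _ F ≤ μ _ F'

end

/-! The lower bounds are communication arguments. Cut the variables and clauses of an encoding `F`
into `A` and its complement, and record for a model which clauses on each side it satisfies through
variables on the other side (`IsCutKey`). Two models with equal records can be spliced along the cut
into a model (`IsCutKey.isModel_mix`). Models with exactly `k` ones in `X`, but different numbers of
them in `A`, must therefore have different records: one of the two splices would have more than `k`
ones. If each side holds a third of `X`, this forces more than `2s/3` records
(`IsCutKey.min_lt_card`).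

Small width provides a balanced cut with few records. In a tree decomposition, a centroid bag of
size at most `w + 1` separates `X`, and one bit per element of the bag suffices
(`exists_balanced_separator`, `isCutKey_of_separator`). For primal and dual treewidth, the Helly
property of subtrees puts all variables of a clause, or all clauses of a variable, into one bag. In
a signed cliquewidth construction, some intermediate graph contains between one and two thirds of
`X`. Its vertices of equal label look alike from outside, so three bits per label suffice
(`CWConstructible.exists_balanced_cut`, `isCutKey_of_labels`). In all four cases `s ≤ 16 ^ w`.

For the upper bound, a binary counter with `O(log s)` bits adds up guessed indicator bits along the
inputs. The guessed set has exactly `k` elements and covers the ones, or has exactly `n - k`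
elements and avoids them, whichever is smaller. The formula is layered with `O(log s)` variables and
clauses per layer, and sweeping over the layers bounds all four widths (`hasTreewidthLE_of_layers`,
`hasCliquewidthLE_of_layers`).

For the bounded measures, the canonical CNF works: each clause contains every variable, so its
unsigned incidence graph is complete bipartite. -/

/-! ### Centroids and separators in trees -/

/-- A tree has fewer edges than nodes, so two nodes `t` choose the same edge `{t, f t}`. This
replaces walking along `f` until it turns back, both for the Helly property and for centroids. -/
theorem SimpleGraph.IsTree.exists_apply_apply_eq {ι : Type} [Finite ι] {T : SimpleGraph ι}
    (hT : T.IsTree) (f : ι → ι) (hf : ∀ t, T.Adj t (f t)) : ∃ t, f (f t) = t := by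
  classical
  have := Fintype.ofFinite ι
  by_contra! h
  have hinj : Function.Injective (fun t => (⟨s(t, f t), hf t⟩ : T.edgeSet)) := by
    intro a b hab
    rcases Sym2.eq_iff.1 (Subtype.ext_iff.1 hab) with h1 | ⟨h1, h2⟩
    · exact h1.1
    · exact absurd (by rw [h2, h1]) (h a)
  have h1 := Fintype.card_le_of_injective _ hinj
  have h2 := hT.card_edgeFinset
  rw [SimpleGraph.edgeFinset_card] at h2
  have h3 : Fintype.card T.edgeSet = Fintype.card {x // x ∈ T.edgeSet} := Fintype.card_congr' rfl
  omega

theorem SimpleGraph.Connected.exists_adj_reachable_deleteIncidenceSet {ι : Type}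
    {T : SimpleGraph ι} (hT : T.Connected) {s t : ι} (hst : s ≠ t) :
    ∃ t', T.Adj t t' ∧ (T.deleteIncidenceSet t).Reachable t' s := by
  obtain ⟨p⟩ := hT.preconnected s t
  induction p with
  | nil => exact absurd rfl hst
  | @cons a b c h p ih =>
    by_cases hb : b = c
    · subst hb
      exact ⟨a, h.symm, SimpleGraph.Reachable.refl _⟩
    · obtain ⟨t', h1, h2⟩ := ih hb
      refine ⟨t', h1, h2.trans (SimpleGraph.Adj.reachable ?_)⟩
      rw [SimpleGraph.deleteIncidenceSet_adj]
      exact ⟨h.symm, hb, hst⟩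

/-- Both connections avoid the edge `tt'`, so together they would join its ends without it, but
every edge of an acyclic graph is a bridge. -/
theorem SimpleGraph.IsAcyclic.not_reachable_deleteIncidenceSet {ι : Type} {T : SimpleGraph ι}
    (hT : T.IsAcyclic) {t t' s : ι} (h : T.Adj t t')
    (h1 : (T.deleteIncidenceSet t).Reachable t' s)
    (h2 : (T.deleteIncidenceSet t').Reachable t s) : False := by
  have hb := SimpleGraph.isAcyclic_iff_forall_adj_isBridge.1 hT h
  rw [SimpleGraph.isBridge_iff] at hb
  have l1 : T.deleteIncidenceSet t ≤ T.deleteEdges {s(t, t')} := by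
    intro a b hab
    rw [SimpleGraph.deleteIncidenceSet_adj] at hab
    simp only [SimpleGraph.deleteEdges_adj, Set.mem_singleton_iff, Sym2.eq_iff]
    tauto
  have l2 : T.deleteIncidenceSet t' ≤ T.deleteEdges {s(t, t')} := by
    intro a b hab
    rw [SimpleGraph.deleteIncidenceSet_adj] at hab
    simp only [SimpleGraph.deleteEdges_adj, Set.mem_singleton_iff, Sym2.eq_iff]
    tauto
  exact hb ((h2.mono l2).trans (h1.mono l1).symm)

/-- All elements of `Q` lie in the same component of the tree after deleting a node outside of
`Q`. -/
def SubtreeLike {ι : Type} (T : SimpleGraph ι) (Q : Set ι) : Prop :=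
  ∀ t, t ∉ Q → ∀ s ∈ Q, ∀ s' ∈ Q, (T.deleteIncidenceSet t).Reachable s s'

theorem SubtreeLike.singleton {ι : Type} (T : SimpleGraph ι) (t : ι) : SubtreeLike T {t} := by
  rintro _ _ s rfl s' rfl
  exact SimpleGraph.Reachable.refl _

theorem SubtreeLike.of_connected {ι : Type} {T : SimpleGraph ι} {Q : Set ι}
    (h : (T.induce Q).Connected) : SubtreeLike T Q := by
  intro t ht s hs s' hs'
  have := h.preconnected ⟨s, hs⟩ ⟨s', hs'⟩
  let φ : T.induce Q →g T.deleteIncidenceSet t := ⟨Subtype.val, by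
    intro a b hab
    rw [SimpleGraph.deleteIncidenceSet_adj]
    exact ⟨hab, fun h => ht (h ▸ a.2), fun h => ht (h ▸ b.2)⟩⟩
  exact this.map φ

/-- Helly property of subtrees. Otherwise every node `t` is missed by some set and points to its
neighbor in the direction of that set. Two adjacent nodes then point at each other, although the
sets they point to share a node. -/
theorem exists_mem_of_pairwise_inter {ι W : Type} [Finite ι] {T : SimpleGraph ι} (hT : T.IsTree)
    (Q : W → Set ι) (hQ : ∀ u, SubtreeLike T (Q u)) (K : Set W)
    (hK : ∀ u ∈ K, ∀ v ∈ K, (Q u ∩ Q v).Nonempty) : ∃ t, ∀ u ∈ K, t ∈ Q u := by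
  by_contra! h
  choose u huK hu using h
  have : ∀ t, ∃ t', T.Adj t t' ∧ ∀ s ∈ Q (u t), (T.deleteIncidenceSet t).Reachable t' s := by
    intro t
    obtain ⟨s, hs, -⟩ := hK _ (huK t) _ (huK t)
    obtain ⟨t', h1, h2⟩ := hT.connected.exists_adj_reachable_deleteIncidenceSet
      (fun h => hu t (h ▸ hs) : s ≠ t)
    exact ⟨t', h1, fun s' hs' => h2.trans (hQ _ t (hu t) s hs s' hs')⟩
  choose f hf hf' using this
  obtain ⟨t, ht⟩ := hT.exists_apply_apply_eq f hf
  obtain ⟨s, hs, hs'⟩ := hK _ (huK t) _ (huK (f t))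
  have := hf' (f t) s hs'
  rw [ht] at this
  exact hT.isAcyclic.not_reachable_deleteIncidenceSet (hf t) (hf' t s hs) this

open Classical in
-- Otherwise every node points towards a component holding more than half of `X`. Two adjacent nodes
-- point at each other, and their heavy components are disjoint.
theorem exists_centroid {ι W : Type} [Finite ι] {T : SimpleGraph ι} (hT : T.IsTree)
    (node : W → ι) (X : Finset W) : ∃ t, ∀ r, r ≠ t →
      2 * {x ∈ X | (T.deleteIncidenceSet t).Reachable r (node x)}.card ≤ X.card := by
  by_contra! h
  choose r hr hr' using h
  choose f hf hf' using fun t =>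
    hT.connected.exists_adj_reachable_deleteIncidenceSet (hr t)
  obtain ⟨t, ht⟩ := hT.exists_apply_apply_eq f hf
  have h1 := hr' t
  have h2 := hr' (f t)
  have hd : Disjoint {x ∈ X | (T.deleteIncidenceSet t).Reachable (r t) (node x)}
      {x ∈ X | (T.deleteIncidenceSet (f t)).Reachable (r (f t)) (node x)} := by
    rw [Finset.disjoint_left]
    intro x hx hx'
    rw [Finset.mem_filter] at hx hx'
    have h3 := (hf' (f t)).trans hx'.2
    rw [ht] at h3
    exact hT.isAcyclic.not_reachable_deleteIncidenceSet (hf t) ((hf' t).trans hx.2) h3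
  have h3 := Finset.card_union_of_disjoint hd
  have h4 : ({x ∈ X | (T.deleteIncidenceSet t).Reachable (r t) (node x)} ∪
      {x ∈ X | (T.deleteIncidenceSet (f t)).Reachable (r (f t)) (node x)}).card ≤ X.card :=
    Finset.card_le_card (Finset.union_subset (Finset.filter_subset _ _) (Finset.filter_subset _ _))
  omega

open Classical in
theorem exists_balanced_grouping {W K : Type} (X : Finset W) (g : W → K)
    (hg : ∀ c, 2 * {x ∈ X | g x = c}.card ≤ X.card) :
    ∃ J : Set K, X.card ≤ 3 * {x ∈ X | g x ∈ J}.card ∧ X.card ≤ 3 * {x ∈ X | g x ∉ J}.card := by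
  let cnt : Set K → ℕ := fun J => {x ∈ X | g x ∈ J}.card
  have split : ∀ J : Set K, cnt J + {x ∈ X | g x ∉ J}.card = X.card := fun J =>
    Finset.card_filter_add_card_filter_not _
  have key : ∀ L : Finset K, X.card ≤ 3 * cnt L →
      ∃ J : Set K, X.card ≤ 3 * cnt J ∧ X.card ≤ 3 * {x ∈ X | g x ∉ J}.card := by
    intro L
    induction L using Finset.induction_on with
    | empty =>
      intro h
      have h0 : cnt ((∅ : Finset K) : Set K) = 0 := by simp [cnt]
      have h1 := split ((∅ : Finset K) : Set K)
      exact ⟨_, h, by omega⟩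
    | insert a L ha ih =>
      intro h
      by_cases hL : X.card ≤ 3 * cnt L
      · exact ih hL
      have h1 := split {a}
      have h2 : 2 * cnt {a} ≤ X.card := hg a
      by_cases hs : X.card ≤ 3 * cnt {a}
      · exact ⟨{a}, hs, by omega⟩
      · refine ⟨_, h, ?_⟩
        have h3 := split (insert a L : Finset K)
        have h4 : cnt (insert a L : Finset K) ≤ cnt {a} + cnt L := by
          refine le_trans (Finset.card_le_card ?_) (Finset.card_union_le _ _)
          intro x
          simp only [Finset.coe_insert, Set.mem_insert_iff, Finset.mem_filter, Finset.mem_union,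
            Set.mem_singleton_iff]
          tauto
        omega
  have full : ∀ J : Set K, (∀ x ∈ X, g x ∈ J) → cnt J = X.card := fun J h =>
    congrArg Finset.card (Finset.filter_true_of_mem h)
  have := full (X.image g : Finset K) fun x hx => Finset.mem_coe.2 (Finset.mem_image_of_mem g hx)
  exact key (X.image g) (by omega)

open Classical in
-- Delete a centroid and distribute the components evenly over two sides. Sets that avoid the
-- centroid and meet lie in a common component.
theorem exists_balanced_separator {ι W : Type} [Finite ι] {T : SimpleGraph ι} (hT : T.IsTree)
    (Q : W → Set ι) (hne : ∀ u, (Q u).Nonempty) (hQ : ∀ u, SubtreeLike T (Q u))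
    (X : Finset W) (hX : 2 ≤ X.card) :
    ∃ (t : ι) (A : Set W), X.card ≤ 3 * {x ∈ X | x ∈ A}.card ∧
      X.card ≤ 3 * {x ∈ X | x ∉ A}.card ∧
      ∀ u v, t ∉ Q u → t ∉ Q v → (Q u ∩ Q v).Nonempty → (u ∈ A ↔ v ∈ A) := by
  choose node hnode using hne
  obtain ⟨t, ht⟩ := exists_centroid hT node X
  -- Deleting the incidence set leaves `t` as an isolated node. The tag splits the elements
  -- represented by `t` itself into singletons, which are at most half of `X` because `X` has at
  -- least two elements.
  let g : W → (T.deleteIncidenceSet t).ConnectedComponent × Option W := fun u =>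
    (SimpleGraph.connectedComponentMk _ (node u), if node u = t then some u else none)
  have hg : ∀ c, 2 * {x ∈ X | g x = c}.card ≤ X.card := by
    rintro ⟨c, o⟩
    cases o with
    | some w =>
      have : {x ∈ X | g x = (c, some w)}.card ≤ 1 := by
        rw [Finset.card_le_one]
        intro a ha b hb
        simp only [g, Finset.mem_filter, Prod.mk.injEq] at ha hb
        grind
      omega
    | none =>
      by_cases hE : {x ∈ X | g x = (c, none)}.Nonempty
      · obtain ⟨x₀, hx₀⟩ := hE
        simp only [g, Finset.mem_filter, Prod.mk.injEq] at hx₀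
        have hx₀t : node x₀ ≠ t := by grind
        refine le_trans (Nat.mul_le_mul_left 2 (Finset.card_le_card ?_)) (ht _ hx₀t)
        intro x hx
        simp only [g, Finset.mem_filter, Prod.mk.injEq] at hx ⊢
        exact ⟨hx.1, SimpleGraph.ConnectedComponent.exact (hx₀.2.1.trans hx.2.1.symm)⟩
      · rw [Finset.not_nonempty_iff_eq_empty] at hE
        simp [hE]
  obtain ⟨J, h1, h2⟩ := exists_balanced_grouping X g (by convert hg)
  refine ⟨t, g ⁻¹' J, h1, h2, ?_⟩
  rintro u v hu hv ⟨s, hsu, hsv⟩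
  have hguv : g u = g v := by
    have e1 : node u ≠ t := fun h => hu (h ▸ hnode u)
    have e2 : node v ≠ t := fun h => hv (h ▸ hnode v)
    simp only [g, if_neg e1, if_neg e2, Prod.mk.injEq, and_true]
    exact SimpleGraph.ConnectedComponent.sound
      ((hQ u t hu _ (hnode u) _ hsu).trans (hQ v t hv _ hsv _ (hnode v)))
  simp only [Set.mem_preimage, hguv]

/-! ### Lower bounds: fooling sets -/

/-- The clause `C` is satisfied by the assignment `a` through a variable on which `B` holds. -/
def Clause.SatOn {V : Type} (C : Clause V) (B : V → Prop) (a : V → Bool) : Prop :=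
  ∃ l ∈ C, B l.1 ∧ a l.1 = l.2

/-- The value of `key` on an assignment determines which clauses on either side of the cut `A` are
satisfied by the assignment through variables on the other side. -/
def IsCutKey {V K : Type} (F : CNFFormula V) (A : Set (V ⊕ {C // C ∈ F})) (key : (V → Bool) → K) :
    Prop :=
  ∀ a a', key a = key a' → ∀ C : {C // C ∈ F},
    (Sum.inr C ∉ A → C.1.SatOn (fun x => Sum.inl x ∈ A) a →
      C.1.SatOn (fun x => Sum.inl x ∈ A) a') ∧
    (Sum.inr C ∈ A → C.1.SatOn (fun x => Sum.inl x ∉ A) a →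
      C.1.SatOn (fun x => Sum.inl x ∉ A) a')

open Classical in
-- Consider a clause on the side of `A`. If `a` satisfies it within `A`, the literal survives. If
-- `a` satisfies it from outside, equal keys say that `a'` does so too, and `a'` is what is used
-- there. The other side is symmetric.
theorem IsCutKey.isModel_mix {V K : Type} {F : CNFFormula V} {A : Set (V ⊕ {C // C ∈ F})}
    {key : (V → Bool) → K} (h : IsCutKey F A key) {a a' : V → Bool} (ha : F.IsModel a)
    (ha' : F.IsModel a') (hk : key a = key a') :
    F.IsModel (fun x => if Sum.inl x ∈ A then a x else a' x) := by
  intro C hC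
  by_cases hA : Sum.inr ⟨C, hC⟩ ∈ A
  · obtain ⟨l, hl, hal⟩ := ha C hC
    by_cases hx : Sum.inl l.1 ∈ A
    · exact ⟨l, hl, by simp [hx, hal]⟩
    · obtain ⟨l', hl', hx', hal'⟩ := (h a a' hk ⟨C, hC⟩).2 hA ⟨l, hl, hx, hal⟩
      exact ⟨l', hl', by simp [hx', hal']⟩
  · obtain ⟨l, hl, hal⟩ := ha' C hC
    by_cases hx : Sum.inl l.1 ∈ A
    · obtain ⟨l', hl', hx', hal'⟩ := (h a' a hk.symm ⟨C, hC⟩).1 hA ⟨l, hl, hx, hal⟩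
      exact ⟨l', hl', by simp [hx', hal']⟩
    · exact ⟨l, hl, by simp [hx, hal]⟩

theorem sum_decide_mem_toNat {n : ℕ} (S : Finset (Fin n)) :
    ∑ i, (decide (i ∈ S)).toNat = S.card := by
  simp [Bool.toNat, Bool.cond_decide]

open Classical in
-- The fooling set consists of `q + 1` models with `k` ones each and `low + i` of them in `A`, for
-- `i ≤ q`.
theorem IsCutKey.min_lt_card {n m k : ℕ} {F : CNFFormula (Fin n ⊕ Fin m)}
    (hF : IsClausalEncoding F (cardinalityConstraint n k)) (hk : k ≤ n)
    {A : Set ((Fin n ⊕ Fin m) ⊕ {C // C ∈ F})} {K : Type} [Fintype K]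
    {key : (Fin n ⊕ Fin m → Bool) → K} (h : IsCutKey F A key) (q : ℕ) (hqk : q ≤ k)
    (hqn : q ≤ n - k)
    (hA : q ≤ {x : Fin n | Sum.inl (Sum.inl x) ∈ A}.toFinset.card)
    (hB : q ≤ {x : Fin n | Sum.inl (Sum.inl x) ∉ A}.toFinset.card) : q < Fintype.card K := by
  set S := {x : Fin n | Sum.inl (Sum.inl x) ∈ A}.toFinset with hS
  set R := {x : Fin n | Sum.inl (Sum.inl x) ∉ A}.toFinset with hR
  have hSR : S.card + R.card = n := by
    have : R = Sᶜ := by ext; simp [hS, hR]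
    rw [this, Finset.card_add_card_compl, Fintype.card_fin]
  have hdisj : Disjoint S R := by
    rw [Finset.disjoint_left]; intro x; simp [hS, hR]
  -- The least number of ones in `S` that lets `R` hold the rest. The four bounds on `q` make `low +
  -- i` ones in `S` and `k - (low + i)` in `R` possible for all `i ≤ q`.
  let low := k - R.card
  have hch : ∀ i : Fin (q + 1), ∃ a : Fin n ⊕ Fin m → Bool, F.IsModel a ∧
      ∃ P Q : Finset (Fin n), P ⊆ S ∧ Q ⊆ R ∧ P.card = low + i ∧ Q.card = k - (low + i) ∧
        ∀ x, a (Sum.inl x) = decide (x ∈ P ∪ Q) := by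
    intro i
    have hi := i.2
    obtain ⟨P, hPS, hP⟩ := Finset.exists_subset_card_eq (s := S) (n := low + i) (by omega)
    obtain ⟨Q, hQR, hQ⟩ := Finset.exists_subset_card_eq (s := R) (n := k - (low + i)) (by omega)
    have h1 : cardinalityConstraint n k (fun x => decide (x ∈ P ∪ Q)) = true := by
      rw [cardinalityConstraint, decide_eq_true_iff, sum_decide_mem_toNat,
        Finset.card_union_of_disjoint (Finset.disjoint_of_subset_left hPS
          (Finset.disjoint_of_subset_right hQR hdisj))]
      omega
    obtain ⟨b, hb⟩ := (hF _).1 h1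
    exact ⟨_, hb, P, Q, hPS, hQR, hP, hQ, fun x => rfl⟩
  choose a ha P Q hPS hQR hP hQ haPQ using hch
  have hinj : Function.Injective (fun i => key (a i)) := by
    have : ∀ i j : Fin (q + 1), i < j → key (a i) ≠ key (a j) := by
      intro i j hij hkey
      -- With the larger share inside `A` and the larger remainder outside, the spliced model has `k
      -- + (j - i) > k` ones.
      have hm := h.isModel_mix (ha j) (ha i) hkey.symm
      have hmem : ∀ x, (if Sum.inl (Sum.inl x) ∈ A then a j (Sum.inl x) else a i (Sum.inl x)) =
          decide (x ∈ P j ∪ Q i) := by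
        intro x
        have e1 : ∀ i, x ∈ P i → Sum.inl (Sum.inl x) ∈ A := fun i hx => by
          simpa [hS] using hPS i hx
        have e2 : ∀ i, x ∈ Q i → Sum.inl (Sum.inl x) ∉ A := fun i hx => by
          simpa [hR] using hQR i hx
        rw [haPQ, haPQ]
        have := e1 i; have := e1 j; have := e2 i; have := e2 j
        simp only [Finset.mem_union]
        split_ifs <;> (congr 1; rw [eq_iff_iff]; tauto)
      have hc : cardinalityConstraint n k (fun x => decide (x ∈ P j ∪ Q i)) = true := by
        rw [hF]
        refine ⟨fun y => if Sum.inl (Sum.inr y) ∈ A then a j (Sum.inr y) else a i (Sum.inr y), ?_⟩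
        convert hm using 1
        funext x
        cases x with
        | inl x => exact (hmem x).symm
        | inr y => rfl
      rw [cardinalityConstraint, decide_eq_true_iff, sum_decide_mem_toNat,
        Finset.card_union_of_disjoint (Finset.disjoint_of_subset_left (hPS j)
          (Finset.disjoint_of_subset_right (hQR i) hdisj)), hP, hQ] at hc
      have hij' : i.1 < j.1 := hij
      have := j.2
      have : low + i.1 ≤ k := by omega
      omega
    intro i j hij
    rcases lt_trichotomy i j with h1 | h1 | h1
    · exact absurd hij (this i j h1)
    · exact h1
    · exact absurd hij.symm (this j i h1)
  have := Fintype.card_le_of_injective _ hinj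
  rw [Fintype.card_fin] at this
  omega

theorem le_sixteen_pow_of_isCutKey {n m k : ℕ} {F : CNFFormula (Fin n ⊕ Fin m)}
    (hF : IsClausalEncoding F (cardinalityConstraint n k)) (hk : k ≤ n)
    (hs : 2 ≤ min k (n - k))
    {A : Set ((Fin n ⊕ Fin m) ⊕ {C // C ∈ F})} {K : Type} [Fintype K]
    {key : (Fin n ⊕ Fin m → Bool) → K} (h : IsCutKey F A key)
    (hA : n ≤ 3 * {x : Fin n | Sum.inl (Sum.inl x) ∈ A}.ncard)
    (hB : n ≤ 3 * {x : Fin n | Sum.inl (Sum.inl x) ∉ A}.ncard)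
    (w : ℕ) (hw : Fintype.card K ≤ 2 ^ (w + 1) ∨ Fintype.card K ≤ 8 ^ w) :
    min k (n - k) ≤ 16 ^ w := by
  classical
  rw [Set.ncard_eq_toFinset_card'] at hA hB
  set s := min k (n - k) with hs'
  -- The number `⌈2s/3⌉` is admissible because each side has at least `n / 3` inputs and `n ≥ 2s`.
  have h1 := h.min_lt_card hF hk ((2 * s + 2) / 3) (by omega) (by omega) (by omega) (by omega)
  -- Here `s ≥ 2` is needed: it forces at least three keys, while `w = 0` allows at most two.
  have hw0 : w ≠ 0 := by
    rintro rfl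
    norm_num at hw
    omega
  have h16 : (16 : ℕ) ^ w = 2 ^ w * 8 ^ w := by rw [← Nat.mul_pow]
  have h2 : 2 ≤ 2 ^ w := Nat.le_self_pow hw0 2
  have h8 : 8 ≤ 8 ^ w := Nat.le_self_pow hw0 8
  have h3 : 2 * s + 3 ≤ 3 * Fintype.card K := by omega
  have h4 : 2 * 8 ^ w ≤ 2 ^ w * 8 ^ w := Nat.mul_le_mul_right _ h2
  have h5 : 2 ^ w * 8 ≤ 2 ^ w * 8 ^ w := Nat.mul_le_mul_left _ h8
  rw [pow_succ] at hw
  omega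

/-- One bit per element of `S`: the value of a variable, or whether a clause is satisfied from
across the cut. A clause outside `S` has all its variables across the cut in `S`, so their values
decide. -/
theorem isCutKey_of_separator {V : Type} {F : CNFFormula V} (A : Set (V ⊕ {C // C ∈ F}))
    (S : Finset (V ⊕ {C // C ∈ F}))
    (h : ∀ x (C : {C // C ∈ F}), C.1.HasVar x → ¬ (Sum.inl x ∈ A ↔ Sum.inr C ∈ A) →
      Sum.inl x ∈ S ∨ Sum.inr C ∈ S) :
    ∃ key : (V → Bool) → (S → Bool), IsCutKey F A key := by
  classical
  refine ⟨fun a u => match u.1 with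
    | Sum.inl x => a x
    | Sum.inr C => decide (C.1.SatOn (fun x => ¬ (Sum.inl x ∈ A ↔ Sum.inr C ∈ A)) a), ?_⟩
  intro a a' hk C
  have key : C.1.SatOn (fun x => ¬ (Sum.inl x ∈ A ↔ Sum.inr C ∈ A)) a →
      C.1.SatOn (fun x => ¬ (Sum.inl x ∈ A ↔ Sum.inr C ∈ A)) a' := by
    intro hsat
    by_cases hC : Sum.inr C ∈ S
    · have := congrFun hk ⟨_, hC⟩
      simpa [hsat] using this
    · obtain ⟨l, hl, hx, hal⟩ := hsat
      have hlS := (h l.1 C ⟨l.2, hl⟩ hx).resolve_right hC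
      have := congrFun hk ⟨_, hlS⟩
      exact ⟨l, hl, hx, by rw [← hal]; exact this.symm⟩
  constructor
  · intro hC; simpa [hC] using key
  · intro hC; simpa [hC] using key

/-! ### Lower bounds for treewidth -/

theorem hasTreewidthLE_treewidth {V : Type} [Finite V] (G : SimpleGraph V) :
    HasTreewidthLE G (treewidth G) :=
  Nat.sInf_mem (exists_hasTreewidthLE G)

theorem TreeDecomposition.subtreeLike {V ι : Type} {G : SimpleGraph V}
    (D : TreeDecomposition G ι) (v : V) : SubtreeLike D.tree {t | v ∈ D.bag t} :=
  SubtreeLike.of_connected (D.connected v)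

theorem TreeDecomposition.exists_bag_of_clique {V ι : Type} [Finite ι] {G : SimpleGraph V}
    (D : TreeDecomposition G ι) (K : Set V) (hK : ∀ u ∈ K, ∀ v ∈ K, u ≠ v → G.Adj u v) :
    ∃ t, ∀ u ∈ K, u ∈ D.bag t := by
  refine exists_mem_of_pairwise_inter D.isTree (fun v => {t | v ∈ D.bag t}) D.subtreeLike K ?_
  intro u hu v hv
  by_cases huv : u = v
  · subst huv
    obtain ⟨t, ht⟩ := D.cover u
    exact ⟨t, ht, ht⟩
  · obtain ⟨t, h1, h2⟩ := D.edge u v (hK u hu v hv huv)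
    exact ⟨t, h1, h2⟩

/-- `Q` represents the variables and clauses of `F` by subtrees of a tree such that incident ones
meet, and wherever one of two incident ones is present, one of the two belongs to the separator. -/
theorem le_sixteen_pow_of_subtrees {n m k : ℕ} {F : CNFFormula (Fin n ⊕ Fin m)}
    (hF : IsClausalEncoding F (cardinalityConstraint n k)) (hk : k ≤ n)
    (hs : 2 ≤ min k (n - k)) {ι : Type} [Finite ι] {T : SimpleGraph ι} (hT : T.IsTree)
    (Q : (Fin n ⊕ Fin m) ⊕ {C // C ∈ F} → Set ι) (hne : ∀ u, (Q u).Nonempty)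
    (hQ : ∀ u, SubtreeLike T (Q u)) (S : ι → Finset ((Fin n ⊕ Fin m) ⊕ {C // C ∈ F})) (w : ℕ)
    (hS : ∀ t, (S t).card ≤ w + 1)
    (hmeet : ∀ x (C : {C // C ∈ F}), C.1.HasVar x → (Q (Sum.inl x) ∩ Q (Sum.inr C)).Nonempty)
    (hsep : ∀ x (C : {C // C ∈ F}), C.1.HasVar x → ∀ t, t ∈ Q (Sum.inl x) ∨ t ∈ Q (Sum.inr C) →
      Sum.inl x ∈ S t ∨ Sum.inr C ∈ S t) :
    min k (n - k) ≤ 16 ^ w := by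
  classical
  let φ : Fin n ↪ (Fin n ⊕ Fin m) ⊕ {C // C ∈ F} :=
    Function.Embedding.inl.trans Function.Embedding.inl
  obtain ⟨t, A, h1, h2, h3⟩ := exists_balanced_separator hT Q hne hQ (Finset.univ.map φ)
    (by rw [Finset.card_map, Finset.card_univ, Fintype.card_fin]; omega)
  obtain ⟨key, hkey⟩ := isCutKey_of_separator A (S t) (by
    intro x C hx hA
    by_contra hcon
    have h4 : t ∉ Q (Sum.inl x) := fun h => hcon (hsep x C hx t (Or.inl h))
    have h5 : t ∉ Q (Sum.inr C) := fun h => hcon (hsep x C hx t (Or.inr h))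
    exact hA (h3 _ _ h4 h5 (hmeet x C hx)))
  have hcount : ∀ (p : (Fin n ⊕ Fin m) ⊕ {C // C ∈ F} → Prop) [DecidablePred p],
      ((Finset.univ.map φ).filter p).card = {x : Fin n | p (Sum.inl (Sum.inl x))}.ncard := by
    intro p _
    rw [Finset.filter_map, Finset.card_map, ← Set.ncard_coe_finset]
    congr 1
    ext x
    simp [φ]
  rw [hcount (· ∈ A), Finset.card_map, Finset.card_univ, Fintype.card_fin] at h1
  rw [hcount (· ∉ A), Finset.card_map, Finset.card_univ, Fintype.card_fin] at h2
  refine le_sixteen_pow_of_isCutKey hF hk hs hkey h1 h2 w (Or.inl ?_)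
  rw [Fintype.card_fun, Fintype.card_bool, Fintype.card_coe]
  exact Nat.pow_le_pow_right (by norm_num) (hS t)

theorem incidenceGraph_adj {V : Type} (F : CNFFormula V) (x : V) (C : {C // C ∈ F}) :
    (incidenceGraph F).Adj (Sum.inl x) (Sum.inr C) ↔ C.1.HasVar x := by
  simp [incidenceGraph]

theorem le_sixteen_pow_incidenceTreewidth {n m k : ℕ} {F : CNFFormula (Fin n ⊕ Fin m)}
    (hF : IsClausalEncoding F (cardinalityConstraint n k)) (hk : k ≤ n)
    (hs : 2 ≤ min k (n - k)) : min k (n - k) ≤ 16 ^ incidenceTreewidth _ F := by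
  obtain ⟨ι, _, D, hD⟩ := hasTreewidthLE_treewidth (incidenceGraph F)
  refine le_sixteen_pow_of_subtrees hF hk hs D.isTree (fun u => {t | u ∈ D.bag t})
    D.cover D.subtreeLike D.bag _ hD ?_ ?_
  · intro x C hx
    exact D.edge _ _ ((incidenceGraph_adj F x C).2 hx)
  · exact fun x C _ t ht => ht

theorem le_sixteen_pow_primalTreewidth {n m k : ℕ} {F : CNFFormula (Fin n ⊕ Fin m)}
    (hF : IsClausalEncoding F (cardinalityConstraint n k)) (hk : k ≤ n)
    (hs : 2 ≤ min k (n - k)) : min k (n - k) ≤ 16 ^ primalTreewidth _ F := by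
  obtain ⟨ι, _, D, hD⟩ := hasTreewidthLE_treewidth (primalGraph F)
  have hcl : ∀ C : {C // C ∈ F}, ∃ t, ∀ x, C.1.HasVar x → x ∈ D.bag t := fun C =>
    D.exists_bag_of_clique {x | C.1.HasVar x} fun x hx y hy hxy => by
      rw [primalGraph, SimpleGraph.fromRel_adj]
      exact ⟨hxy, Or.inl ⟨C.1, C.2, hx, hy⟩⟩
  choose τ hτ using hcl
  -- A clause is represented by a single node whose bag contains all its variables, so variables
  -- alone form the separator.
  refine le_sixteen_pow_of_subtrees hF hk hs D.isTree
    (Sum.elim (fun x => {t | x ∈ D.bag t}) fun C => {τ C}) ?_ ?_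
    (fun t => (D.bag t).map Function.Embedding.inl) (primalTreewidth _ F) ?_ ?_ ?_
  · rintro (x | C)
    · exact D.cover x
    · exact Set.singleton_nonempty _
  · rintro (x | C)
    · exact D.subtreeLike x
    · exact SubtreeLike.singleton _ _
  · intro t
    rw [Finset.card_map]
    exact hD t
  · exact fun x C hx => ⟨τ C, hτ C x hx, rfl⟩
  · rintro x C hx t (ht | rfl)
    · exact Or.inl (Finset.mem_map_of_mem _ ht)
    · exact Or.inl (Finset.mem_map_of_mem _ (hτ C x hx))

theorem le_sixteen_pow_dualTreewidth {n m k : ℕ} {F : CNFFormula (Fin n ⊕ Fin m)}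
    (hF : IsClausalEncoding F (cardinalityConstraint n k)) (hk : k ≤ n)
    (hs : 2 ≤ min k (n - k)) : min k (n - k) ≤ 16 ^ dualTreewidth _ F := by
  obtain ⟨ι, _, D, hD⟩ := hasTreewidthLE_treewidth (dualGraph F)
  have hcl : ∀ x, ∃ t, ∀ C : {C // C ∈ F}, C.1.HasVar x → C ∈ D.bag t := fun x =>
    D.exists_bag_of_clique {C | C.1.HasVar x} fun C hC C' hC' hCC' => by
      rw [dualGraph, SimpleGraph.fromRel_adj]
      exact ⟨hCC', Or.inl ⟨x, hC, hC'⟩⟩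
  choose τ hτ using hcl
  -- Dually, a variable sits at a node whose bag contains all its clauses.
  refine le_sixteen_pow_of_subtrees hF hk hs D.isTree
    (Sum.elim (fun x => {τ x}) fun C => {t | C ∈ D.bag t}) ?_ ?_
    (fun t => (D.bag t).map Function.Embedding.inr) (dualTreewidth _ F) ?_ ?_ ?_
  · rintro (x | C)
    · exact Set.singleton_nonempty _
    · exact D.cover C
  · rintro (x | C)
    · exact SubtreeLike.singleton _ _
    · exact D.subtreeLike C
  · intro t
    rw [Finset.card_map]
    exact hD t
  · exact fun x C hx => ⟨τ x, rfl, hτ x C hx⟩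
  · rintro x C hx t (rfl | ht)
    · exact Or.inr (Finset.mem_map_of_mem _ (hτ x C hx))
    · exact Or.inr (Finset.mem_map_of_mem _ ht)

/-! ### Lower bounds for signed cliquewidth -/

theorem CWConstructible.lab_ne_none_of_adj {V E : Type} {k : ℕ} {lab : V → Option (Fin k)}
    {G : E → SimpleGraph V} (h : CWConstructible k lab G) {e : E} {u v : V} (huv : (G e).Adj u v) :
    lab u ≠ none := by
  induction h generalizing e u v with
  | create => exact absurd huv (by simp)
  | union _ _ _ ih₁ ih₂ =>
    rcases huv with huv | huv
    · simp [ih₁ huv]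
    · simp [ih₂ huv]
  | join _ s i j hij ih =>
    dsimp only at huv
    split_ifs at huv
    · rcases huv with huv | huv
      · exact ih huv
      · rw [SimpleGraph.fromRel_adj] at huv
        rcases huv.2 with h | h <;> simp [h.1, h.2]
    · exact ih huv
  | rename _ i j hij ih =>
    have := ih huv
    dsimp only
    split_ifs <;> simp [this]

open Classical in
-- Descend in the construction as long as a part has more than a third of `N` elements of `X`. At a
-- union of two parts without that many, the union has at most two thirds. Later operations treat
-- vertices of equal label alike, so vertices of `A` that share the label `ℓ` get the same final
-- label and the same neighbors outside `A`.
theorem CWConstructible.exists_balanced_cut {V E : Type} [Finite V] {k : ℕ}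
    {lab : V → Option (Fin k)} {G : E → SimpleGraph V} (h : CWConstructible k lab G)
    (X : Set V) (N : ℕ) (hN : 2 ≤ N) (hlab : N < 3 * {v ∈ X | lab v ≠ none}.ncard) :
    ∃ (A : Set V) (ℓ : V → Option (Fin k)), N ≤ 3 * (X ∩ A).ncard ∧ 3 * (X ∩ A).ncard ≤ 2 * N ∧
      ∀ u ∈ A, ℓ u ≠ none ∧ lab u ≠ none ∧ ∀ v ∈ A, ℓ u = ℓ v →
        lab u = lab v ∧ ∀ w ∉ A, ∀ e, (G e).Adj u w ↔ (G e).Adj v w := by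
  induction h with
  | create v i =>
    have h1 : {w ∈ X | (if w = v then some i else none) ≠ none}.ncard ≤ 1 := by
      refine (Set.ncard_le_ncard (t := {v}) ?_ (Set.toFinite _)).trans (Set.ncard_singleton v).le
      intro w hw
      have := hw.2
      simp at this
      exact this
    refine ⟨{w | (if w = v then some i else none) ≠ none}, fun w => if w = v then some i else none,
      hlab.le, ?_, ?_⟩
    -- A single vertex is not too many since `N ≥ 2`.
    · change 3 * {w ∈ X | (if w = v then some i else none) ≠ none}.ncard ≤ _
      omega
    · intro u hu
      refine ⟨hu, hu, fun w _ he => ⟨he, ?_⟩⟩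
      simp
  | @union lab₁ lab₂ G₁ G₂ h₁ h₂ disj ih₁ ih₂ =>
    by_cases c₁ : N < 3 * {v ∈ X | lab₁ v ≠ none}.ncard
    · obtain ⟨A, ℓ, hA, hA', h⟩ := ih₁ c₁
      refine ⟨A, ℓ, hA, hA', fun u hu => ?_⟩
      obtain ⟨a1, a2, a3⟩ := h u hu
      refine ⟨a1, by simp [a2], fun v hv huv => ?_⟩
      obtain ⟨b1, b2⟩ := a3 v hv huv
      have d1 := (disj u).resolve_left a2
      have d2 := (disj v).resolve_left (h v hv).2.1
      refine ⟨by simp [b1, d1, d2], fun w hw e => ?_⟩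
      have n1 : ¬ (G₂ e).Adj u w := fun h => h₂.lab_ne_none_of_adj h d1
      have n2 : ¬ (G₂ e).Adj v w := fun h => h₂.lab_ne_none_of_adj h d2
      simp only [SimpleGraph.sup_adj, n1, n2, or_false, b2 w hw e]
    by_cases c₂ : N < 3 * {v ∈ X | lab₂ v ≠ none}.ncard
    · obtain ⟨A, ℓ, hA, hA', h⟩ := ih₂ c₂
      refine ⟨A, ℓ, hA, hA', fun u hu => ?_⟩
      obtain ⟨a1, a2, a3⟩ := h u hu
      refine ⟨a1, by simp [a2], fun v hv huv => ?_⟩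
      obtain ⟨b1, b2⟩ := a3 v hv huv
      have d1 := (disj u).resolve_right a2
      have d2 := (disj v).resolve_right (h v hv).2.1
      refine ⟨by simp [b1, d1, d2], fun w hw e => ?_⟩
      have n1 : ¬ (G₁ e).Adj u w := fun h => h₁.lab_ne_none_of_adj h d1
      have n2 : ¬ (G₁ e).Adj v w := fun h => h₁.lab_ne_none_of_adj h d2
      simp only [SimpleGraph.sup_adj, n1, n2, false_or, b2 w hw e]
    · have hu : {v ∈ X | (lab₁ v).or (lab₂ v) ≠ none}.ncard ≤
          {v ∈ X | lab₁ v ≠ none}.ncard + {v ∈ X | lab₂ v ≠ none}.ncard := by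
        refine (Set.ncard_le_ncard ?_ (Set.toFinite _)).trans (Set.ncard_union_le _ _)
        rintro v ⟨hv, hv'⟩
        simp only [ne_eq, Option.or_eq_none_iff, not_and_or] at hv'
        exact hv'.imp (⟨hv, ·⟩) (⟨hv, ·⟩)
      refine ⟨{v | (lab₁ v).or (lab₂ v) ≠ none}, fun v => (lab₁ v).or (lab₂ v), hlab.le, ?_, ?_⟩
      · change 3 * {v ∈ X | (lab₁ v).or (lab₂ v) ≠ none}.ncard ≤ _
        omega
      · intro u hu
        refine ⟨hu, hu, fun v hv huv => ⟨huv, fun w hw e => ?_⟩⟩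
        have hc := CWConstructible.union h₁ h₂ disj
        have n1 : ∀ u, ¬ (G₁ e ⊔ G₂ e).Adj u w := fun u h =>
          hw (hc.lab_ne_none_of_adj (e := e) (u := w) (v := u) h.symm)
        simp only [n1]
  | @join lab G h s i j hij ih =>
    obtain ⟨A, ℓ, hA, hA', h⟩ := ih hlab
    refine ⟨A, ℓ, hA, hA', fun u hu => ?_⟩
    obtain ⟨a1, a2, a3⟩ := h u hu
    refine ⟨a1, a2, fun v hv huv => ?_⟩
    obtain ⟨b1, b2⟩ := a3 v hv huv
    refine ⟨b1, fun w hw e => ?_⟩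
    have huw : u ≠ w := fun h => hw (h ▸ hu)
    have hvw : v ≠ w := fun h => hw (h ▸ hv)
    dsimp only
    split_ifs
    · simp only [SimpleGraph.sup_adj, SimpleGraph.fromRel_adj, b2 w hw e, b1, huw, hvw, ne_eq,
        not_false_eq_true]
    · exact b2 w hw e
  | @rename lab G h i j hij ih =>
    have hne : ∀ v, (if lab v = some i then some j else lab v) ≠ none ↔ lab v ≠ none := by
      intro v
      split_ifs with h <;> simp [h]
    simp only [hne] at hlab ⊢
    obtain ⟨A, ℓ, hA, hA', h⟩ := ih hlab
    refine ⟨A, ℓ, hA, hA', fun u hu => ?_⟩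
    obtain ⟨a1, a2, a3⟩ := h u hu
    refine ⟨a1, a2, fun v hv huv => ?_⟩
    obtain ⟨b1, b2⟩ := a3 v hv huv
    exact ⟨by rw [b1], b2⟩

theorem signedIncidenceGraph_adj {V : Type} (F : CNFFormula V) (b : Bool) (x : V)
    (C : {C // C ∈ F}) :
    (signedIncidenceGraph F b).Adj (Sum.inl x) (Sum.inr C) ↔ (x, b) ∈ C.1 := by
  simp [signedIncidenceGraph]

open Classical in
-- For a clause outside `A` it only matters which values occur among the variables of each label,
-- since such variables occur in it with the same signs. Clauses of `A` with equal label contain the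
-- same outside literals, so one bit per label tells whether they are satisfied from outside. With
-- `k` labels there are `2k + k` bits, hence `8 ^ k` keys.
theorem isCutKey_of_labels {V : Type} {F : CNFFormula V} (A : Set (V ⊕ {C // C ∈ F})) {k : ℕ}
    (ℓ : V ⊕ {C // C ∈ F} → Option (Fin k)) (h : ∀ u ∈ A, ℓ u ≠ none ∧ ∀ v ∈ A, ℓ u = ℓ v →
      ∀ w ∉ A, ∀ b, (signedIncidenceGraph F b).Adj u w ↔ (signedIncidenceGraph F b).Adj v w) :
    IsCutKey F A (K := (Fin k → Bool → Bool) × (Fin k → Bool)) (fun a =>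
      (fun i b => decide (∃ x, Sum.inl x ∈ A ∧ ℓ (Sum.inl x) = some i ∧ a x = b),
        fun i => decide (∃ C, Sum.inr C ∈ A ∧ ℓ (Sum.inr C) = some i ∧
          C.1.SatOn (fun x => Sum.inl x ∉ A) a))) := by
  intro a a' hk C
  simp only [Prod.mk.injEq, funext_iff, decide_eq_decide] at hk
  constructor
  · rintro hC ⟨⟨x, b⟩, hl, hx, hal⟩
    obtain ⟨i, hi⟩ := Option.ne_none_iff_exists'.1 (h _ hx).1
    obtain ⟨y, hy, hyi, hya⟩ := (hk.1 i b).1 ⟨x, hx, hi, hal⟩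
    have := (h _ hx).2 _ hy (hi.trans hyi.symm) _ hC b
    rw [signedIncidenceGraph_adj, signedIncidenceGraph_adj] at this
    exact ⟨(y, b), this.1 hl, hy, hya⟩
  · intro hC hsat
    obtain ⟨i, hi⟩ := Option.ne_none_iff_exists'.1 (h _ hC).1
    obtain ⟨D, hD, hDi, ⟨x, b⟩, hl, hx, hal⟩ := (hk.2 i).1 ⟨C, hC, hi, hsat⟩
    have := (h _ hC).2 _ hD (hi.trans hDi.symm) _ hx b
    rw [SimpleGraph.adj_comm, signedIncidenceGraph_adj, SimpleGraph.adj_comm,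
      signedIncidenceGraph_adj] at this
    exact ⟨(x, b), this.2 hl, hx, hal⟩

theorem le_sixteen_pow_signedIncidenceCliquewidth {n m k : ℕ} {F : CNFFormula (Fin n ⊕ Fin m)}
    (hF : IsClausalEncoding F (cardinalityConstraint n k)) (hk : k ≤ n)
    (hs : 2 ≤ min k (n - k)) : min k (n - k) ≤ 16 ^ signedIncidenceCliquewidth _ F := by
  classical
  have : Nonempty ((Fin n ⊕ Fin m) ⊕ {C // C ∈ F}) := ⟨Sum.inl (Sum.inl ⟨0, by omega⟩)⟩
  have hw : HasCliquewidthLE (signedIncidenceGraph F) (signedIncidenceCliquewidth _ F) :=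
    Nat.sInf_mem (exists_hasCliquewidthLE (signedIncidenceGraph F))
  obtain ⟨lab, hlab, hc⟩ := hw
  let φ : Fin n ↪ (Fin n ⊕ Fin m) ⊕ {C // C ∈ F} :=
    Function.Embedding.inl.trans Function.Embedding.inl
  have hcount : ∀ A : Set ((Fin n ⊕ Fin m) ⊕ {C // C ∈ F}),
      (Set.range φ ∩ A).ncard = {x : Fin n | Sum.inl (Sum.inl x) ∈ A}.ncard := by
    intro A
    rw [← Set.ncard_image_of_injective _ φ.injective]
    congr 1
    ext u
    simp only [Set.mem_inter_iff, Set.mem_range, Set.mem_image, Set.mem_ofPred_eq]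
    constructor
    · rintro ⟨⟨x, rfl⟩, hx⟩; exact ⟨x, hx, rfl⟩
    · rintro ⟨x, hx, rfl⟩; exact ⟨⟨x, rfl⟩, hx⟩
  obtain ⟨A, ℓ, h1, h2, h3⟩ := hc.exists_balanced_cut (Set.range φ) n (by omega) (by
    have h1 : {v ∈ Set.range φ | lab v ≠ none} = Set.range φ := by
      ext v; simp [hlab]
    have h2 := hcount Set.univ
    rw [Set.inter_univ] at h2
    rw [h1, h2]
    simp
    omega)
  rw [hcount] at h1 h2
  refine le_sixteen_pow_of_isCutKey hF hk hs (isCutKey_of_labels A ℓ fun u hu =>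
    ⟨(h3 u hu).1, fun v hv huv => ((h3 u hu).2.2 v hv huv).2⟩) h1 ?_ _ (Or.inr ?_)
  · have := Set.ncard_add_ncard_compl {x : Fin n | Sum.inl (Sum.inl x) ∈ A}
    rw [Nat.card_eq_fintype_card, Fintype.card_fin] at this
    change _ ≤ 3 * {x : Fin n | Sum.inl (Sum.inl x) ∈ A}ᶜ.ncard
    omega
  · simp only [Fintype.card_prod, Fintype.card_fun, Fintype.card_bool, Fintype.card_fin]
    rw [← Nat.mul_pow]
    norm_num

/-! ### Layered graphs -/

theorem SimpleGraph.pathGraph_isTree (n : ℕ) : (SimpleGraph.pathGraph (n + 1)).IsTree := by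
  have hc := SimpleGraph.pathGraph_connected n
  rw [SimpleGraph.isTree_iff_connected_and_card]
  refine ⟨hc, le_antisymm ?_ hc.card_vert_le_card_edgeSet_add_one⟩
  let f : Fin n → (SimpleGraph.pathGraph (n + 1)).edgeSet := fun i =>
    ⟨s(i.castSucc, i.succ), by rw [SimpleGraph.mem_edgeSet, SimpleGraph.pathGraph_adj]; simp⟩
  have hf : Function.Surjective f := by
    rintro ⟨e, he⟩
    induction e using Sym2.ind with
    | _ u v =>
      rw [SimpleGraph.mem_edgeSet, SimpleGraph.pathGraph_adj] at he
      rcases he with h | h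
      · refine ⟨⟨u, by omega⟩, Subtype.ext (Sym2.eq_iff.2 (Or.inl ⟨?_, ?_⟩))⟩
        · exact Fin.ext rfl
        · exact Fin.ext h
      · refine ⟨⟨v, by omega⟩, Subtype.ext (Sym2.eq_iff.2 (Or.inr ⟨?_, ?_⟩))⟩
        · exact Fin.ext rfl
        · exact Fin.ext h
  have := Nat.card_le_card_of_surjective f hf
  simp only [Nat.card_fin] at this ⊢
  omega

theorem SimpleGraph.induce_connected_of_pairwise {ι : Type} (T : SimpleGraph ι) (Q : Set ι)
    (hne : Q.Nonempty) (h : ∀ s ∈ Q, ∀ t ∈ Q, s = t ∨ T.Adj s t) : (T.induce Q).Connected := by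
  have := hne.to_subtype
  refine ⟨fun s t => ?_⟩
  rcases h s s.2 t t.2 with h | h
  · rw [Subtype.ext h]
  · exact SimpleGraph.Adj.reachable h

/-- A path decomposition whose bags are the pairs of consecutive layers. -/
theorem hasTreewidthLE_of_layers {V : Type} [Finite V] (G : SimpleGraph V) (st : V → ℕ) (p : ℕ)
    (hp : ∀ t, {v | st v = t}.ncard ≤ p) (hadj : ∀ u v, G.Adj u v → st u ≤ st v + 1) :
    HasTreewidthLE G (2 * p) := by
  classical
  have := Fintype.ofFinite V
  let N := Finset.univ.sup st
  have hN : ∀ v, st v ≤ N := fun v => Finset.le_sup (Finset.mem_univ v)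
  refine ⟨Fin (N + 1), inferInstance, ⟨SimpleGraph.pathGraph (N + 1),
    SimpleGraph.pathGraph_isTree N,
    fun t => Finset.univ.filter fun v => st v = t ∨ st v = t + 1, ?_, ?_, ?_⟩, ?_⟩
  · intro v
    have := hN v
    exact ⟨⟨st v, by omega⟩, by simp⟩
  · intro u v huv
    have h1 := hadj u v huv
    have h2 := hadj v u huv.symm
    have h3 := hN u
    have h4 := hN v
    refine ⟨⟨min (st u) (st v), by omega⟩, ?_, ?_⟩ <;>
      (simp only [Finset.mem_filter, Finset.mem_univ, true_and]; omega)
  · intro v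
    apply SimpleGraph.induce_connected_of_pairwise
    · have := hN v
      exact ⟨⟨st v, by omega⟩, by simp⟩
    · intro s hs t ht
      simp only [Set.mem_ofPred_eq, Finset.mem_filter, Finset.mem_univ, true_and] at hs ht
      rw [SimpleGraph.pathGraph_adj, Fin.ext_iff]
      omega
  · intro t
    have h1 : ∀ j, (Finset.univ.filter fun v => st v = j).card ≤ p := by
      intro j
      refine le_trans (le_of_eq ?_) (hp j)
      rw [← Set.ncard_coe_finset]
      congr 1
      ext v
      simp
    change (Finset.univ.filter fun v => st v = t ∨ st v = t + 1).card ≤ _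
    rw [Finset.filter_or]
    have := Finset.card_union_le (Finset.univ.filter fun v => st v = t)
      (Finset.univ.filter fun v => st v = t + 1)
    have := h1 t
    have := h1 (t + 1)
    omega

/-- A labeled graph that is empty or constructible. -/
def CWBuildable {V E : Type} (k : ℕ) (lab : V → Option (Fin k)) (G : E → SimpleGraph V) : Prop :=
  ((∀ v, lab v = none) ∧ ∀ e, G e = ⊥) ∨ CWConstructible k lab G

namespace CWBuildable

variable {V E : Type} {k : ℕ}

theorem union {lab₁ lab₂ : V → Option (Fin k)} {G₁ G₂ : E → SimpleGraph V}
    (h₁ : CWBuildable k lab₁ G₁) (h₂ : CWBuildable k lab₂ G₂)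
    (disj : ∀ v, lab₁ v = none ∨ lab₂ v = none) :
    CWBuildable k (fun v => (lab₁ v).or (lab₂ v)) (fun e => G₁ e ⊔ G₂ e) := by
  rcases h₁ with ⟨h₁, h₁'⟩ | h₁
  · simpa [h₁, h₁'] using h₂
  rcases h₂ with ⟨h₂, h₂'⟩ | h₂
  · right; simpa [h₂, h₂'] using h₁
  · exact Or.inr (.union h₁ h₂ disj)

open Classical in
theorem join {lab : V → Option (Fin k)} {G : E → SimpleGraph V} (h : CWBuildable k lab G)
    (s : E) (i j : Fin k) (hij : i ≠ j) :
    CWBuildable k lab (fun e =>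
      if e = s then G e ⊔ SimpleGraph.fromRel fun u v => lab u = some i ∧ lab v = some j
      else G e) := by
  rcases h with ⟨h, h'⟩ | h
  · refine Or.inl ⟨h, fun e => ?_⟩
    ext u v
    dsimp only
    split_ifs <;> simp [h, h']
  · exact Or.inr (h.join s i j hij)

open Classical in
theorem rename {lab : V → Option (Fin k)} {G : E → SimpleGraph V} (h : CWBuildable k lab G)
    (i j : Fin k) (hij : i ≠ j) :
    CWBuildable k (fun v => if lab v = some i then some j else lab v) G := by
  rcases h with ⟨h, h'⟩ | h
  · exact Or.inl ⟨fun v => by simp [h], h'⟩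
  · exact Or.inr (h.rename i j hij)

open Classical in
theorem edgeless (S : Finset V) (ℓ : V → Fin k) :
    CWBuildable (E := E) k (fun v => if v ∈ S then some (ℓ v) else none) (fun _ => ⊥) := by
  induction S using Finset.induction_on with
  | empty => exact Or.inl ⟨by simp, by simp⟩
  | insert a S ha ih =>
    have h0 : CWBuildable (E := E) k (fun w => if w = a then some (ℓ a) else none) (fun _ => ⊥) :=
      Or.inr (.create a (ℓ a))
    convert h0.union ih ?_ using 1
    · funext w
      by_cases h : w = a
      · simp [h]
      · by_cases h' : w ∈ S <;> simp [h, h']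
    · funext _; simp
    · intro v
      by_cases h : v = a
      · right; rw [h]; simp [ha]
      · left; simp [h]

/-- Arbitrary edges can be inserted between vertices with unique labels. -/
theorem sup_fromRel {lab : V → Option (Fin k)} {G : E → SimpleGraph V}
    (h : CWBuildable k lab G) (P : Finset (E × V × V))
    (hP : ∀ p ∈ P, p.2.1 ≠ p.2.2 ∧ lab p.2.1 ≠ none ∧ lab p.2.2 ≠ none ∧
      (∀ w, lab w = lab p.2.1 → w = p.2.1) ∧ ∀ w, lab w = lab p.2.2 → w = p.2.2) :
    CWBuildable k lab (fun e => G e ⊔ SimpleGraph.fromRel fun u v => (e, u, v) ∈ P) := by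
  classical
  induction P using Finset.induction_on with
  | empty =>
    convert h using 2 with e
    ext u v; simp
  | insert p P _ ih =>
    have ih := ih fun q hq => hP q (Finset.mem_insert_of_mem hq)
    obtain ⟨s, a, b⟩ := p
    obtain ⟨hab, ha, hb, ha', hb'⟩ := hP _ (Finset.mem_insert_self _ _)
    dsimp only at hab ha hb ha' hb'
    obtain ⟨i, hi⟩ := Option.ne_none_iff_exists'.1 ha
    obtain ⟨j, hj⟩ := Option.ne_none_iff_exists'.1 hb
    have hai : ∀ w, lab w = some i ↔ w = a := fun w =>
      ⟨fun hw => ha' w (hw.trans hi.symm), fun hw => hw ▸ hi⟩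
    have hbj : ∀ w, lab w = some j ↔ w = b := fun w =>
      ⟨fun hw => hb' w (hw.trans hj.symm), fun hw => hw ▸ hj⟩
    have hij : i ≠ j := by
      rintro rfl
      exact hab ((hbj a).1 hi)
    convert ih.join s i j hij using 2 with e
    simp only [hai, hbj]
    by_cases hs : e = s
    · subst hs
      ext u v
      simp only [SimpleGraph.sup_adj, SimpleGraph.fromRel_adj, Finset.mem_insert, Prod.mk.injEq,
        true_and, if_true]
      tauto
    · ext u v
      simp [hs]

open Classical in
theorem rename_finset {lab : V → Option (Fin k)} {G : E → SimpleGraph V}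
    (h : CWBuildable k lab G) (L : Finset (Fin k)) (d : Fin k) (hd : d ∉ L) :
    CWBuildable k (fun v => if ∃ i ∈ L, lab v = some i then some d else lab v) G := by
  induction L using Finset.induction_on with
  | empty => simpa using h
  | insert a L ha ih =>
    rw [Finset.mem_insert, not_or] at hd
    convert (ih hd.2).rename a d (Ne.symm hd.1) using 1
    funext v
    by_cases h1 : ∃ i ∈ L, lab v = some i
    · simp [h1]
    · by_cases h2 : lab v = some a
      · have h3 : ∃ i ∈ insert a L, lab v = some i := ⟨a, Finset.mem_insert_self _ _, h2⟩
        rw [if_pos h3, if_neg h1, if_pos h2]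
      · simp [h1, h2]

end CWBuildable

/-- Sweep over the layers while only the vertices of the last two carry individual labels. Two
blocks of `p` labels, used alternately, and one label for finished vertices suffice. -/
theorem hasCliquewidthLE_of_layers {V E : Type} [Finite V] [Nonempty V] [Finite E]
    (G : E → SimpleGraph V) (st : V → ℕ) (p : ℕ) (hp : ∀ t, {v | st v = t}.ncard ≤ p)
    (hadj : ∀ e u v, (G e).Adj u v → st u ≤ st v + 1) : HasCliquewidthLE G (2 * p + 1) := by
  classical
  have := Fintype.ofFinite V
  have := Fintype.ofFinite E
  have hcol : ∀ t, ∃ c : {v // st v = t} → Fin p, Function.Injective c := by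
    intro t
    have h1 : Fintype.card {v // st v = t} ≤ Fintype.card (Fin p) := by
      rw [Fintype.card_fin, ← Nat.card_eq_fintype_card]
      exact hp t
    obtain ⟨c⟩ := Function.Embedding.nonempty_of_card_le h1
    exact ⟨c, c.injective⟩
  choose c hc using hcol
  let col : V → ℕ := fun v => c (st v) ⟨v, rfl⟩
  have hcolp : ∀ v, col v < p := fun v => (c (st v) ⟨v, rfl⟩).2
  have hcolinj : ∀ u v, st u = st v → col u = col v → u = v := by
    have : ∀ t (u : {v // st v = t}), c (st u.1) ⟨u.1, rfl⟩ = c t u := by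
      rintro t ⟨u, rfl⟩
      rfl
    intro u v h1 h2
    have h3 : c (st v) ⟨u, h1⟩ = c (st v) ⟨v, rfl⟩ :=
      (this (st v) ⟨u, h1⟩).symm.trans (Fin.ext h2)
    exact congrArg Subtype.val (hc _ h3)
  -- The parity of the layer selects the block, and label `0` is kept for finished vertices.
  let lam : V → Fin (2 * p + 1) := fun v => ⟨st v % 2 * p + col v + 1, by
    have := hcolp v
    have : st v % 2 * p ≤ 1 * p := Nat.mul_le_mul_right _ (by omega)
    omega⟩
  have hlam0 : ∀ v, lam v ≠ 0 := fun v h => by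
    have := congrArg Fin.val h
    simp [lam] at this
  have hlam : ∀ u v, st u ≤ st v + 1 → st v ≤ st u + 1 → lam u = lam v → u = v := by
    intro u v h1 h2 h3
    have h4 : st u % 2 * p + col u + 1 = st v % 2 * p + col v + 1 := congrArg Fin.val h3
    have := hcolp u
    have := hcolp v
    rcases Nat.mod_two_eq_zero_or_one (st u) with hu | hu <;>
      rcases Nat.mod_two_eq_zero_or_one (st v) with hv | hv <;>
      rw [hu, hv] at h4
    · exact hcolinj u v (by omega) (by omega)
    · omega
    · omega
    · exact hcolinj u v (by omega) (by omega)
  -- Invariant of the sweep: all edges among layers below `t` are present, layer `t - 1` has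
  -- individual labels, and earlier layers are finished. A step adds layer `t`, inserts its edges,
  -- and then relabels layer `t - 1` by `0`.
  have key : ∀ t, CWBuildable (2 * p + 1)
      (fun v => if st v < t then (if st v + 1 = t then some (lam v) else some 0) else none)
      (fun e => SimpleGraph.fromRel fun u v => (G e).Adj u v ∧ st u < t ∧ st v < t) := by
    intro t
    induction t with
    | zero =>
      left
      refine ⟨by simp, fun e => ?_⟩
      ext u v; simp
    | succ t ih =>
      have h1 := ih.union (CWBuildable.edgeless (Finset.univ.filter fun v => st v = t) lam) (by
        intro v
        by_cases h : st v = t <;> simp [h])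
      have hlab1 : (fun v => (if st v < t then (if st v + 1 = t then some (lam v) else some 0)
          else none).or (if v ∈ Finset.univ.filter fun v => st v = t then some (lam v) else none)) =
          fun v => if st v < t + 1 then (if t ≤ st v + 1 then some (lam v) else some 0)
            else none := by
        funext v
        simp only [Finset.mem_filter, Finset.mem_univ, true_and]
        split_ifs <;> first | rfl | omega
      rw [hlab1] at h1
      have hlabt : ∀ v, st v < t + 1 → t ≤ st v + 1 → ∀ w, (if st w < t + 1 then
          (if t ≤ st w + 1 then some (lam w) else some 0) else none) = some (lam v) → w = v := by
        intro v hv hv' w hw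
        split_ifs at hw
        · exact hlam w v (by omega) (by omega) (Option.some.inj hw)
        · exact absurd (Option.some.inj hw).symm (hlam0 v)
      have h2 := h1.sup_fromRel (Finset.univ.filter fun q => (G q.1).Adj q.2.1 q.2.2 ∧
        st q.2.1 < t + 1 ∧ st q.2.2 < t + 1 ∧ (st q.2.1 = t ∨ st q.2.2 = t)) (by
          rintro ⟨e, u, v⟩ hq
          simp only [Finset.mem_filter, Finset.mem_univ, true_and] at hq
          obtain ⟨hq1, hq2, hq3, hq4⟩ := hq
          have := hadj e u v hq1
          have := hadj e v u hq1.symm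
          have hu : t ≤ st u + 1 := by omega
          have hv : t ≤ st v + 1 := by omega
          refine ⟨hq1.ne, ?_, ?_, ?_, ?_⟩
          · simp [hq2, hu]
          · simp [hq3, hv]
          · simpa [hq2, hu] using hlabt u hq2 hu
          · simpa [hq3, hv] using hlabt v hq3 hv)
      have h3 := h2.rename_finset
        (Finset.univ.filter fun i => ∃ v, st v + 1 = t ∧ lam v = i) 0 (by simp [hlam0])
      convert h3 using 1
      · funext v
        by_cases hv : st v < t + 1
        · by_cases hvt : st v = t
          · have hno : ¬ ∃ i ∈ Finset.univ.filter fun i => ∃ v, st v + 1 = t ∧ lam v = i,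
                some (lam v) = some i := by
              simp only [Finset.mem_filter, Finset.mem_univ, true_and, Option.some.injEq]
              rintro ⟨i, ⟨w, hw, rfl⟩, hwv⟩
              have := hlam v w (by omega) (by omega) hwv
              subst this
              omega
            have hv' : t ≤ st v + 1 := by omega
            have hv'' : st v + 1 = t + 1 := by omega
            simp only [hv, hv', if_true, if_neg hno]
            rw [if_pos hv'']
          · by_cases hv' : st v + 1 = t
            · have hyes : ∃ i ∈ Finset.univ.filter fun i => ∃ v, st v + 1 = t ∧ lam v = i,
                  some (lam v) = some i := by
                simp only [Finset.mem_filter, Finset.mem_univ, true_and, Option.some.injEq]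
                exact ⟨_, ⟨v, hv', rfl⟩, rfl⟩
              have hv'' : t ≤ st v + 1 := by omega
              have hv3 : ¬ st v + 1 = t + 1 := by omega
              simp only [hv, hv'', hv3, if_true, if_pos hyes, if_false]
            · have hv'' : ¬ t ≤ st v + 1 := by omega
              have hv3 : ¬ st v + 1 = t + 1 := by omega
              simp only [hv, hv'', hv3, if_true, if_false, ite_self]
        · simp [hv]
      · funext e
        ext u v
        simp only [SimpleGraph.sup_adj, SimpleGraph.fromRel_adj, Finset.mem_filter, sup_bot_eq,
          Finset.mem_univ, true_and, (G e).adj_comm v u]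
        constructor
        · rintro ⟨hne, h⟩
          have h' : (G e).Adj u v ∧ st u < t + 1 ∧ st v < t + 1 := by tauto
          obtain ⟨a1, a2, a3⟩ := h'
          by_cases hl : st u < t ∧ st v < t
          · exact Or.inl ⟨hne, Or.inl ⟨a1, hl⟩⟩
          · exact Or.inr ⟨hne, Or.inl ⟨a1, a2, a3, by omega⟩⟩
        · rintro (⟨hne, h⟩ | ⟨hne, h⟩)
          · exact ⟨hne, by rcases h with h | h <;> [left; right] <;>
              exact ⟨h.1, by omega, by omega⟩⟩
          · exact ⟨hne, by tauto⟩
  let N := Finset.univ.sup st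
  have hN : ∀ v, st v < N + 1 := fun v => Nat.lt_succ_of_le (Finset.le_sup (Finset.mem_univ v))
  rcases key (N + 1) with ⟨h, -⟩ | h
  · exfalso
    obtain ⟨v⟩ := ‹Nonempty V›
    have := h v
    simp only [hN, if_true] at this
    split_ifs at this
  · have hG : (fun e => SimpleGraph.fromRel fun u v =>
        (G e).Adj u v ∧ st u < N + 1 ∧ st v < N + 1) = G := by
      funext e
      ext u v
      simp only [hN, SimpleGraph.fromRel_adj, and_true, (G e).adj_comm v u, or_self]
      exact ⟨And.right, fun h => ⟨h.ne, h⟩⟩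
    rw [hG] at h
    refine ⟨_, fun v => ?_, h⟩
    simp only [hN, if_true]
    split_ifs <;> simp

/-! ### Layered formulas -/

/-- Every clause contains only variables of its own layer and of the next one, and the layers are
small. -/
structure IsLayered {V : Type} (F : CNFFormula V) (sv : V → ℕ) (sc : {C // C ∈ F} → ℕ) (p q : ℕ) :
    Prop where
  hasVar : ∀ (C : {C // C ∈ F}) x, C.1.HasVar x → sv x = sc C ∨ sv x = sc C + 1
  vars : ∀ t, {x | sv x = t}.ncard ≤ p
  clauses : ∀ t, {C | sc C = t}.ncard ≤ q

namespace IsLayered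

variable {V : Type} {F : CNFFormula V} {sv : V → ℕ} {sc : {C // C ∈ F} → ℕ} {p q : ℕ}

theorem primalTreewidth_le [Finite V] (h : IsLayered F sv sc p q) : primalTreewidth _ F ≤ 2 * p := by
  refine Nat.sInf_le (hasTreewidthLE_of_layers _ sv p h.vars ?_)
  intro x y hxy
  rw [primalGraph, SimpleGraph.fromRel_adj] at hxy
  obtain ⟨-, ⟨C, hC, h1, h2⟩ | ⟨C, hC, h1, h2⟩⟩ := hxy
  all_goals
    have := h.hasVar ⟨C, hC⟩ _ h1
    have := h.hasVar ⟨C, hC⟩ _ h2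
    omega

theorem dualTreewidth_le (h : IsLayered F sv sc p q) : dualTreewidth _ F ≤ 2 * q := by
  refine Nat.sInf_le (hasTreewidthLE_of_layers _ sc q h.clauses ?_)
  intro C D hCD
  rw [dualGraph, SimpleGraph.fromRel_adj] at hCD
  obtain ⟨-, ⟨x, h1, h2⟩ | ⟨x, h1, h2⟩⟩ := hCD
  all_goals
    have := h.hasVar _ _ h1
    have := h.hasVar _ _ h2
    omega

theorem ncard_elim_le (h : IsLayered F sv sc p q) (t : ℕ) :
    {u | Sum.elim sv sc u = t}.ncard ≤ p + q := by
  have : {u | Sum.elim sv sc u = t} = Sum.inl '' {x | sv x = t} ∪ Sum.inr '' {C | sc C = t} := by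
    ext (x | C) <;> simp
  rw [this]
  refine (Set.ncard_union_le _ _).trans (add_le_add ?_ ?_)
  · rw [Set.ncard_image_of_injective _ Sum.inl_injective]
    exact h.vars t
  · rw [Set.ncard_image_of_injective _ Sum.inr_injective]
    exact h.clauses t

theorem incidenceTreewidth_le [Finite V] (h : IsLayered F sv sc p q) :
    incidenceTreewidth _ F ≤ 2 * (p + q) := by
  refine Nat.sInf_le (hasTreewidthLE_of_layers _ (Sum.elim sv sc) _ h.ncard_elim_le ?_)
  intro u v huv
  rw [incidenceGraph, SimpleGraph.fromRel_adj] at huv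
  obtain ⟨-, ⟨x, C, rfl, rfl, hx⟩ | ⟨x, C, rfl, rfl, hx⟩⟩ := huv
  all_goals
    have := h.hasVar _ _ hx
    simp only [Sum.elim_inl, Sum.elim_inr]
    omega

theorem signedIncidenceCliquewidth_le [Finite V] [Nonempty V] (h : IsLayered F sv sc p q) :
    signedIncidenceCliquewidth _ F ≤ 2 * (p + q) + 1 := by
  refine Nat.sInf_le (hasCliquewidthLE_of_layers _ (Sum.elim sv sc) _ h.ncard_elim_le ?_)
  intro b u v huv
  rw [signedIncidenceGraph, SimpleGraph.fromRel_adj] at huv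
  obtain ⟨-, ⟨x, C, rfl, rfl, hx⟩ | ⟨x, C, rfl, rfl, hx⟩⟩ := huv
  all_goals
    have := h.hasVar C x ⟨b, hx⟩
    simp only [Sum.elim_inl, Sum.elim_inr]
    omega

end IsLayered

/-! ### Binary counters -/

/-- `y i` is the state of a counter with `b` bits before step `i`, and `c i` are the carry bits of
the addition in step `i`, where `c i 0` is the bit that is added. The final state is `s`. -/
structure IsCounterRun (n b s : ℕ) (y c : ℕ → ℕ → Bool) : Prop where
  gate : ∀ i < n, ∀ j < b,
    2 * (c i (j + 1)).toNat + (y (i + 1) j).toNat = (y i j).toNat + (c i j).toNat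
  carry : ∀ i < n, c i b = false
  start : ∀ j < b, y 0 j = false
  final : ∀ j < b, y n j = s.testBit j

theorem Nat.mod_two_pow_succ_eq_add (x j : ℕ) :
    x % 2 ^ (j + 1) = x % 2 ^ j + 2 ^ j * (x.testBit j).toNat := by
  rw [Nat.mod_pow_succ, Nat.toNat_testBit]

theorem sum_testBit_mul_two_pow (s b : ℕ) :
    ∑ j ∈ Finset.range b, (s.testBit j).toNat * 2 ^ j = s % 2 ^ b := by
  induction b with
  | zero => simp [Nat.mod_one]
  | succ b ih => rw [Finset.sum_range_succ, ih, Nat.mod_two_pow_succ_eq_add, mul_comm]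

/-- Summing the gate equations with weights `2 ^ j` telescopes the carries, so step `i` adds `c i 0`
to the state. There is no overflow as the last carry is zero. -/
theorem IsCounterRun.sum_eq {n b s : ℕ} {y c : ℕ → ℕ → Bool} (h : IsCounterRun n b s y c)
    (hs : s < 2 ^ b) : ∑ i ∈ Finset.range n, (c i 0).toNat = s := by
  let val : ℕ → ℕ → ℕ := fun i b => ∑ j ∈ Finset.range b, (y i j).toNat * 2 ^ j
  have step : ∀ i < n, ∀ j ≤ b,
      val (i + 1) j + (c i j).toNat * 2 ^ j = val i j + (c i 0).toNat := by
    intro i hi j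
    induction j with
    | zero => intro _; simp [val]
    | succ j ih =>
      intro hj
      have h1 := ih (by omega)
      have h2 := congrArg (· * 2 ^ j) (h.gate i hi j (by omega))
      simp only [val, Finset.sum_range_succ] at h1 ⊢
      rw [pow_succ]
      linarith
  have hval : ∀ i ≤ n, val i b = ∑ i ∈ Finset.range i, (c i 0).toNat := by
    intro i
    induction i with
    | zero =>
      intro _
      refine Finset.sum_eq_zero fun j hj => ?_
      rw [h.start j (Finset.mem_range.1 hj)]
      simp
    | succ i ih =>
      intro hi
      have h1 := step i (by omega) b le_rfl
      rw [h.carry i (by omega), ih (by omega)] at h1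
      rw [Finset.sum_range_succ, ← h1]
      simp
  rw [← hval n le_rfl, ← Nat.mod_eq_of_lt hs, ← sum_testBit_mul_two_pow]
  refine Finset.sum_congr rfl fun j hj => ?_
  rw [h.final j (Finset.mem_range.1 hj)]

/-- The carry into bit `j` is set exactly when the addition overflows the lower `j` bits. The gate
equation is the difference of this fact for `j + 1` and for `j`, divided by `2 ^ j`. -/
theorem two_mul_carry_add_testBit (N j : ℕ) (g : Bool) :
    2 * (decide (2 ^ (j + 1) ≤ N % 2 ^ (j + 1) + g.toNat)).toNat + ((N + g.toNat).testBit j).toNat =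
      (N.testBit j).toNat + (decide (2 ^ j ≤ N % 2 ^ j + g.toNat)).toNat := by
  have hmod : ∀ j, (N + g.toNat) % 2 ^ j +
      2 ^ j * (decide (2 ^ j ≤ N % 2 ^ j + g.toNat)).toNat = N % 2 ^ j + g.toNat := by
    intro j
    have h1 : N % 2 ^ j < 2 ^ j := Nat.mod_lt _ (by positivity)
    have h2 := Bool.toNat_le g
    have h3 : (N + g.toNat) % 2 ^ j = (N % 2 ^ j + g.toNat) % 2 ^ j := by simp
    rw [h3]
    by_cases h4 : 2 ^ j ≤ N % 2 ^ j + g.toNat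
    · have h5 : N % 2 ^ j + g.toNat = 2 ^ j := by omega
      simp [h5]
    · rw [Nat.mod_eq_of_lt (by omega)]
      simp [h4]
  have h1 := hmod j
  have h2 := hmod (j + 1)
  rw [Nat.mod_two_pow_succ_eq_add (N + g.toNat)] at h2
  have h3 := Nat.mod_two_pow_succ_eq_add N j
  have h4 : (0 : ℕ) < 2 ^ j := by positivity
  refine Nat.eq_of_mul_eq_mul_left h4 ?_
  generalize (decide (2 ^ (j + 1) ≤ N % 2 ^ (j + 1) + g.toNat)).toNat = c' at *
  rw [h3, pow_succ] at h2
  linarith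

theorem exists_isCounterRun (n b s : ℕ) (g : ℕ → Bool) (hs : s < 2 ^ b)
    (hg : ∑ i ∈ Finset.range n, (g i).toNat = s) :
    ∃ y c, IsCounterRun n b s y c ∧ ∀ i, c i 0 = g i := by
  let P : ℕ → ℕ := fun i => ∑ i ∈ Finset.range i, (g i).toNat
  have hP : ∀ i, P (i + 1) = P i + (g i).toNat := fun i => Finset.sum_range_succ _ _
  have hmono : Monotone P := monotone_nat_of_le_succ fun i => by rw [hP]; omega
  refine ⟨fun i j => (P i).testBit j, fun i j => decide (2 ^ j ≤ P i % 2 ^ j + (g i).toNat),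
    ⟨?_, ?_, ?_, ?_⟩, ?_⟩
  · intro i _ j _
    rw [hP]
    exact two_mul_carry_add_testBit _ _ _
  · intro i hi
    -- No partial sum exceeds the final value `s < 2 ^ b`, so the top carry vanishes.
    have h1 : P (i + 1) ≤ P n := hmono hi
    have h2 : P n = s := hg
    have h3 := Nat.mod_le (P i) (2 ^ b)
    rw [hP] at h1
    rw [decide_eq_false_iff_not]
    omega
  · intro j _
    simp [P]
  · intro j _
    exact congrArg (Nat.testBit · j) hg
  · intro i
    cases hgi : g i <;> simp [hgi, Nat.mod_one]

/-- The set of ones can be enlarged to exactly `k` elements since `k ≤ n`. This trades the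
inequality for an exact count that a counter can check at its end. -/
theorem exists_indicator_of_cardinalityConstraint (n k : ℕ) (hk : k ≤ n) (a : Fin n → Bool) :
    cardinalityConstraint n k a = true ↔ ∃ g : Fin n → Bool,
      (∀ i, a i = false ∨ g i = true) ∧ ∑ i, (g i).toNat = k := by
  have hsum : ∀ g : Fin n → Bool, ∑ i, (g i).toNat = (Finset.univ.filter (g · = true)).card := by
    intro g
    rw [Finset.card_filter]
    refine Finset.sum_congr rfl fun i _ => ?_
    cases g i <;> rfl
  rw [cardinalityConstraint, decide_eq_true_iff]
  constructor
  · intro h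
    rw [hsum] at h
    obtain ⟨S, h1, -, h2⟩ := Finset.exists_subsuperset_card_eq
      (Finset.subset_univ (Finset.univ.filter (a · = true))) h (by simpa using hk)
    refine ⟨fun i => decide (i ∈ S), fun i => ?_, by rw [sum_decide_mem_toNat, h2]⟩
    cases hi : a i
    · simp
    · right
      simpa using h1 (Finset.mem_filter.2 ⟨Finset.mem_univ i, hi⟩)
  · rintro ⟨g, h1, rfl⟩
    refine Finset.sum_le_sum fun i _ => ?_
    rcases h1 i with h | h
    · simp [h]
    · rw [h]; exact Bool.toNat_le _

/-- Guessing the complementary set of `n - k` zeros keeps the counter small when `n - k < k`. -/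
theorem exists_indicator_of_cardinalityConstraint' (n k : ℕ) (hk : k ≤ n) (a : Fin n → Bool) :
    cardinalityConstraint n k a = true ↔ ∃ g : Fin n → Bool,
      (∀ i, a i = false ∨ g i = false) ∧ ∑ i, (g i).toNat = n - k := by
  have hsum : ∀ g : Fin n → Bool, ∑ i, (g i).toNat + ∑ i, (!g i).toNat = n := by
    intro g
    rw [← Finset.sum_add_distrib]
    refine (Finset.sum_congr rfl (g := fun _ => 1) fun i _ => ?_).trans (by simp)
    cases g i <;> rfl
  rw [exists_indicator_of_cardinalityConstraint n k hk]
  constructor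
  · rintro ⟨g, h1, h2⟩
    refine ⟨fun i => !g i, fun i => by simpa using h1 i, ?_⟩
    have := hsum g
    simp only
    omega
  · rintro ⟨g, h1, h2⟩
    refine ⟨fun i => !g i, fun i => by simpa using h1 i, ?_⟩
    have := hsum g
    simp only
    omega

/-! ### A layered encoding of cardinality constraints by binary counters -/

/-- Indices of the state bits `(i, j, true)` and of the carry bits `(i, j, false)`. -/
abbrev CounterAux (n b : ℕ) : Type := Fin (n + 1) × Fin (b + 1) × Bool

abbrev CounterVar (n b : ℕ) : Type := Fin n ⊕ Fin (Fintype.card (CounterAux n b))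

/-- Indices wrap around modulo `n + 1` and `b + 1`; only `i ≤ n` and `j ≤ b` are meaningful.
Position `b` is needed for the outgoing carry. -/
noncomputable def counterVar (n b i j : ℕ) (t : Bool) : CounterVar n b :=
  Sum.inr (Fintype.equivFin (CounterAux n b) (Fin.ofNat (n + 1) i, Fin.ofNat (b + 1) j, t))

noncomputable def counterStage (n b : ℕ) : CounterVar n b → ℕ :=
  Sum.elim (fun x => x) fun z => ((Fintype.equivFin (CounterAux n b)).symm z).1

theorem counterStage_counterVar {n b i : ℕ} (hi : i ≤ n) (j : ℕ) (t : Bool) :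
    counterStage n b (counterVar n b i j t) = i := by
  simp [counterStage, counterVar, Nat.mod_eq_of_lt (Nat.lt_succ_of_le hi)]

/-- The clause that excludes the values `p` of four variables. -/
noncomputable def gateClause (n b i j : ℕ) (p : Bool × Bool × Bool × Bool) :
    Clause (CounterVar n b) :=
  {(counterVar n b i (j + 1) false, !p.1), (counterVar n b (i + 1) j true, !p.2.1),
    (counterVar n b i j true, !p.2.2.1), (counterVar n b i j false, !p.2.2.2)}

noncomputable def gateClauses (n b i : ℕ) : CNFFormula (CounterVar n b) :=
  ((Finset.range b ×ˢ Finset.univ).filter fun q : ℕ × Bool × Bool × Bool × Bool =>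
    2 * q.2.1.toNat + q.2.2.1.toNat ≠ q.2.2.2.1.toNat + q.2.2.2.2.toNat).image
      fun q => gateClause n b i q.1 q.2

/-- The bit added in a step is free unless the input is one, in which case it must be `σ`: `true`
when a superset of the ones is counted, `false` when a set of zeros is. -/
noncomputable def stepClauses (n b : ℕ) (σ : Bool) (i : Fin n) : CNFFormula (CounterVar n b) :=
  gateClauses n b i ∪ {{(counterVar n b i b false, false)},
    {(Sum.inl i, false), (counterVar n b i 0 false, σ)}}

noncomputable def stateClauses (n b s i : ℕ) : CNFFormula (CounterVar n b) :=
  (Finset.range b).image fun j => {(counterVar n b i j true, s.testBit j)}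

noncomputable def layerClauses (n b s : ℕ) (σ : Bool) (i : ℕ) : CNFFormula (CounterVar n b) :=
  (if h : i < n then stepClauses n b σ ⟨i, h⟩ else ∅) ∪
    ((if i = 0 then stateClauses n b 0 0 else ∅) ∪ if i = n then stateClauses n b s n else ∅)

noncomputable def counterFormula (n b s : ℕ) (σ : Bool) : CNFFormula (CounterVar n b) :=
  (Finset.range (n + 1)).biUnion (layerClauses n b s σ)

section Semantics

variable {n b s : ℕ} {σ : Bool} (a : CounterVar n b → Bool)

theorem gateClauses_isModel (i : ℕ) : (gateClauses n b i).IsModel a ↔ ∀ j < b,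
    2 * (a (counterVar n b i (j + 1) false)).toNat + (a (counterVar n b (i + 1) j true)).toNat =
      (a (counterVar n b i j true)).toNat + (a (counterVar n b i j false)).toNat := by
  simp only [CNFFormula.IsModel, gateClauses, Finset.forall_mem_image, Finset.mem_filter,
    Finset.mem_product, Finset.mem_range, Finset.mem_univ, and_true, gateClause,
    Finset.exists_mem_insert, Finset.mem_singleton, exists_eq_left]
  constructor
  · intro h j hj
    by_contra hne
    have := @h (j, a (counterVar n b i (j + 1) false), a (counterVar n b (i + 1) j true),
      a (counterVar n b i j true), a (counterVar n b i j false)) ⟨hj, hne⟩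
    simp at this
  · rintro h ⟨j, p₁, p₂, p₃, p₄⟩ ⟨hj, hne⟩
    have := h j hj
    simp only [Bool.eq_not] at hne ⊢
    by_contra! hcon
    obtain ⟨rfl, rfl, rfl, rfl⟩ := hcon
    exact hne this

theorem stateClauses_isModel (i : ℕ) : (stateClauses n b s i).IsModel a ↔ ∀ j < b,
    a (counterVar n b i j true) = s.testBit j := by
  simp only [CNFFormula.IsModel, stateClauses, Finset.forall_mem_image, Finset.mem_range,
    Finset.mem_singleton, exists_eq_left]

theorem CNFFormula.isModel_union {V : Type} [DecidableEq V] (F G : CNFFormula V) (a : V → Bool) :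
    CNFFormula.IsModel (F ∪ G) a ↔ F.IsModel a ∧ G.IsModel a := by
  simp only [CNFFormula.IsModel, Finset.mem_union]
  exact ⟨fun h => ⟨fun C hC => h C (Or.inl hC), fun C hC => h C (Or.inr hC)⟩,
    fun h C hC => hC.elim (h.1 C) (h.2 C)⟩

theorem stepClauses_isModel (i : Fin n) : (stepClauses n b σ i).IsModel a ↔
    (gateClauses n b i).IsModel a ∧ a (counterVar n b i b false) = false ∧
      (a (Sum.inl i) = false ∨ a (counterVar n b i 0 false) = σ) := by
  rw [stepClauses, CNFFormula.isModel_union]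
  refine and_congr Iff.rfl ?_
  simp only [CNFFormula.IsModel, Finset.forall_mem_insert, Finset.mem_singleton, forall_eq,
    Finset.exists_mem_insert, exists_eq_left]

theorem counterFormula_isModel : (counterFormula n b s σ).IsModel a ↔
    IsCounterRun n b s (fun i j => a (counterVar n b i j true))
      (fun i j => a (counterVar n b i j false)) ∧
      ∀ i : Fin n, a (Sum.inl i) = false ∨ a (counterVar n b i 0 false) = σ := by
  have h0 : (counterFormula n b s σ).IsModel a ↔
      ∀ i < n + 1, (layerClauses n b s σ i).IsModel a := by
    simp only [CNFFormula.IsModel, counterFormula, Finset.mem_biUnion, Finset.mem_range]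
    exact ⟨fun h i hi C hC => h C ⟨i, hi, hC⟩, fun h C ⟨i, hi, hC⟩ => h i hi C hC⟩
  have h1 : ∀ i, (layerClauses n b s σ i).IsModel a ↔
      (∀ h : i < n, (stepClauses n b σ ⟨i, h⟩).IsModel a) ∧
        (i = 0 → (stateClauses n b 0 0).IsModel a) ∧
          (i = n → (stateClauses n b s n).IsModel a) := by
    intro i
    have hempty : CNFFormula.IsModel (∅ : CNFFormula (CounterVar n b)) a := by
      simp [CNFFormula.IsModel]
    rw [layerClauses, CNFFormula.isModel_union, CNFFormula.isModel_union]
    refine and_congr ?_ (and_congr ?_ ?_)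
    · split_ifs with h <;> simp [h, hempty]
    · split_ifs with h <;> simp [h, hempty]
    · split_ifs with h <;> simp [h, hempty]
  rw [h0]
  simp only [h1, stepClauses_isModel, gateClauses_isModel, stateClauses_isModel]
  constructor
  · intro h
    refine ⟨⟨fun i hi => ((h i (by omega)).1 hi).1, fun i hi => ((h i (by omega)).1 hi).2.1,
      ?_, (h n (by omega)).2.2 rfl⟩, fun i => ((h i (by omega)).1 i.2).2.2⟩
    simpa using (h 0 (by omega)).2.1 rfl
  · rintro ⟨h, h'⟩ i -
    refine ⟨fun hi => ⟨h.gate i hi, h.carry i hi, h' ⟨i, hi⟩⟩, ?_, ?_⟩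
    · rintro rfl
      simpa using h.start
    · rintro rfl
      exact h.final

end Semantics

theorem counterFormula_isClausalEncoding {n b s : ℕ} {σ : Bool} (hs : s < 2 ^ b)
    {f : (Fin n → Bool) → Bool} (hf : ∀ a, f a = true ↔ ∃ g : Fin n → Bool,
      (∀ i, a i = false ∨ g i = σ) ∧ ∑ i, (g i).toNat = s) :
    IsClausalEncoding (counterFormula n b s σ) f := by
  intro a
  rw [hf]
  simp only [counterFormula_isModel, Sum.elim_inl]
  constructor
  · rintro ⟨g, h1, h2⟩
    obtain ⟨y, c, h3, h4⟩ := exists_isCounterRun n b s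
      (fun i => if h : i < n then g ⟨i, h⟩ else false) hs (by
        rw [Finset.sum_range, ← h2]
        refine Finset.sum_congr rfl fun i _ => ?_
        simp)
    let v : CounterAux n b → Bool := fun q => if q.2.2 then y q.1 q.2.1 else c q.1 q.2.1
    have hv : ∀ i ≤ n, ∀ j ≤ b, ∀ t, (Sum.elim a (v ∘ (Fintype.equivFin (CounterAux n b)).symm))
        (counterVar n b i j t) = if t then y i j else c i j := by
      intro i hi j hj t
      simp [counterVar, v, Nat.mod_eq_of_lt (Nat.lt_succ_of_le hi),
        Nat.mod_eq_of_lt (Nat.lt_succ_of_le hj)]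
    refine ⟨v ∘ (Fintype.equivFin (CounterAux n b)).symm, ⟨?_, ?_, ?_, ?_⟩, ?_⟩
    · intro i hi j hj
      rw [hv _ (by omega) _ (by omega), hv _ (by omega) _ (by omega), hv _ (by omega) _ (by omega),
        hv _ (by omega) _ (by omega)]
      exact h3.gate i hi j hj
    · intro i hi
      rw [hv _ (by omega) _ (by omega)]
      exact h3.carry i hi
    · intro j hj
      rw [hv _ (by omega) _ (by omega)]
      exact h3.start j hj
    · intro j hj
      rw [hv _ (by omega) _ (by omega)]
      exact h3.final j hj
    · intro i
      rw [hv _ (by omega) _ (by omega)]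
      simpa [h4] using h1 i
  · rintro ⟨v, h1, h2⟩
    refine ⟨fun i => Sum.elim a v (counterVar n b i 0 false), h2, ?_⟩
    have := h1.sum_eq hs
    rw [Finset.sum_range] at this
    exact this

/-! ### Layer sizes of the counter formula -/

theorem gateClauses_card_le (n b i : ℕ) : (gateClauses n b i).card ≤ 16 * b := by
  refine Finset.card_image_le.trans ((Finset.card_filter_le _ _).trans (le_of_eq ?_))
  rw [Finset.card_product, Finset.card_range, Finset.card_univ]
  simp only [Fintype.card_prod, Fintype.card_bool]
  omega

theorem stateClauses_card_le (n b s i : ℕ) : (stateClauses n b s i).card ≤ b :=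
  Finset.card_image_le.trans (Finset.card_range b).le

theorem layerClauses_card_le (n b s : ℕ) (σ : Bool) (i : ℕ) :
    (layerClauses n b s σ i).card ≤ 18 * b + 2 := by
  have h1 : (if h : i < n then stepClauses n b σ ⟨i, h⟩ else ∅).card ≤ 16 * b + 2 := by
    split_ifs with h
    · exact (Finset.card_union_le _ _).trans
        (add_le_add (gateClauses_card_le n b i) Finset.card_le_two)
    · simp
  have h2 : (if i = 0 then stateClauses n b 0 0 else ∅).card ≤ b := by
    split_ifs
    · exact stateClauses_card_le n b 0 0
    · simp
  have h3 : (if i = n then stateClauses n b s n else ∅).card ≤ b := by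
    split_ifs
    · exact stateClauses_card_le n b s n
    · simp
  refine (Finset.card_union_le _ _).trans ((add_le_add h1 ((Finset.card_union_le _ _).trans
    (add_le_add h2 h3))).trans ?_)
  omega

theorem counterStage_of_hasVar {n b s : ℕ} {σ : Bool} {i : ℕ} {C : Clause (CounterVar n b)}
    (hC : C ∈ layerClauses n b s σ i) {x : CounterVar n b} (hx : C.HasVar x) :
    counterStage n b x = i ∨ counterStage n b x = i + 1 := by
  obtain ⟨v, hx⟩ := hx
  have hstate : ∀ s' i', i' ≤ n → C ∈ stateClauses n b s' i' → counterStage n b x = i' := by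
    intro s' i' hi' hC
    obtain ⟨j, -, rfl⟩ := Finset.mem_image.1 hC
    rw [Finset.mem_singleton, Prod.mk.injEq] at hx
    rw [hx.1, counterStage_counterVar hi']
  rw [layerClauses, Finset.mem_union, Finset.mem_union] at hC
  rcases hC with hC | hC | hC
  · split_ifs at hC with h
    · rw [stepClauses, Finset.mem_union, Finset.mem_insert, Finset.mem_singleton] at hC
      rcases hC with hC | rfl | rfl
      · obtain ⟨q, -, rfl⟩ := Finset.mem_image.1 hC
        simp only [gateClause, Finset.mem_insert, Finset.mem_singleton, Prod.mk.injEq] at hx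
        rcases hx with ⟨rfl, -⟩ | ⟨rfl, -⟩ | ⟨rfl, -⟩ | ⟨rfl, -⟩
        · exact Or.inl (counterStage_counterVar h.le _ _)
        · exact Or.inr (counterStage_counterVar h _ _)
        · exact Or.inl (counterStage_counterVar h.le _ _)
        · exact Or.inl (counterStage_counterVar h.le _ _)
      · rw [Finset.mem_singleton, Prod.mk.injEq] at hx
        rw [hx.1]
        exact Or.inl (counterStage_counterVar h.le _ _)
      · simp only [Finset.mem_insert, Finset.mem_singleton, Prod.mk.injEq] at hx
        rcases hx with ⟨rfl, -⟩ | ⟨rfl, -⟩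
        · exact Or.inl rfl
        · exact Or.inl (counterStage_counterVar h.le _ _)
    · simp at hC
  · split_ifs at hC with h
    · subst h
      exact Or.inl (hstate _ _ (Nat.zero_le _) hC)
    · simp at hC
  · split_ifs at hC with h
    · subst h
      exact Or.inl (hstate _ _ le_rfl hC)
    · simp at hC

theorem ncard_counterStage_le (n b t : ℕ) : {x | counterStage n b x = t}.ncard ≤ 2 * b + 3 := by
  let φ : CounterVar n b → Option (Fin (b + 1) × Bool) :=
    -- Per layer there are one input and `2 * (b + 1)` counter variables.
    Sum.elim (fun _ => none) fun z => some ((Fintype.equivFin (CounterAux n b)).symm z).2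
  have hφ : Set.InjOn φ {x | counterStage n b x = t} := by
    rintro (x | z) hx (x' | z') hx' h
    · exact congrArg Sum.inl (Fin.ext (hx.trans hx'.symm))
    · simp [φ] at h
    · simp [φ] at h
    · have h1 : (((Fintype.equivFin (CounterAux n b)).symm z).1 : ℕ) =
        ((Fintype.equivFin (CounterAux n b)).symm z').1 := hx.trans hx'.symm
      have h2 := Option.some.inj h
      exact congrArg Sum.inr ((Fintype.equivFin (CounterAux n b)).symm.injective
        (Prod.ext (Fin.ext h1) h2))
  rw [← hφ.ncard_image]
  refine (Set.ncard_le_ncard (Set.subset_univ _) (Set.toFinite _)).trans (le_of_eq ?_)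
  rw [Set.ncard_univ, Nat.card_eq_fintype_card]
  simp
  omega

theorem counterFormula_isLayered (n b s : ℕ) (σ : Bool) :
    ∃ sc, IsLayered (counterFormula n b s σ) (counterStage n b) sc (2 * b + 3) (18 * b + 2) := by
  have : ∀ C : {C // C ∈ counterFormula n b s σ}, ∃ i, C.1 ∈ layerClauses n b s σ i := by
    rintro ⟨C, hC⟩
    obtain ⟨i, -, h⟩ := Finset.mem_biUnion.1 hC
    exact ⟨i, h⟩
  choose sc hsc using this
  refine ⟨sc, fun C x hx => counterStage_of_hasVar (hsc C) hx, ncard_counterStage_le n b, ?_⟩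
  intro t
  rw [← Set.ncard_image_of_injective _ Subtype.val_injective]
  refine (Set.ncard_le_ncard ?_ (Finset.finite_toSet (layerClauses n b s σ t))).trans ?_
  · rintro _ ⟨C, rfl, rfl⟩
    exact hsc C
  · rw [Set.ncard_coe_finset]
    exact layerClauses_card_le n b s σ t

/-! ### Canonical formulas without auxiliary variables -/

/-- The formula that excludes all assignments that do not satisfy `f`. -/
def canonicalFormula {n : ℕ} (f : (Fin n → Bool) → Bool) : CNFFormula (Fin n ⊕ Fin 0) :=
  (Finset.univ.filter fun a => f a = false).image fun a =>
    Finset.univ.image fun i => (Sum.inl i, !a i)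

theorem canonicalFormula_isClausalEncoding {n : ℕ} (f : (Fin n → Bool) → Bool) :
    IsClausalEncoding (canonicalFormula f) f := by
  intro a
  simp only [CNFFormula.IsModel, canonicalFormula, Finset.forall_mem_image, Finset.mem_filter,
    Finset.mem_univ, true_and, Finset.exists_mem_image, Sum.elim_inl]
  constructor
  · intro h
    refine ⟨Fin.elim0, fun a' ha' => ?_⟩
    by_contra! hcon
    have : a = a' := funext fun i => by simpa using hcon i
    simp [← this, h] at ha'
  · rintro ⟨-, h⟩
    by_contra ha
    obtain ⟨i, hi⟩ := @h a (by simpa using ha)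
    simp at hi

theorem canonicalFormula_hasVar {n : ℕ} (f : (Fin n → Bool) → Bool)
    (C : {C // C ∈ canonicalFormula f}) (x : Fin n ⊕ Fin 0) : C.1.HasVar x := by
  obtain ⟨C, hC⟩ := C
  obtain ⟨a, -, rfl⟩ := Finset.mem_image.1 hC
  obtain x | x := x
  · exact ⟨!a x, Finset.mem_image_of_mem _ (Finset.mem_univ x)⟩
  · exact x.elim0

theorem canonicalFormula_incidenceGraph_adj {n : ℕ} (f : (Fin n → Bool) → Bool)
    (u v : (Fin n ⊕ Fin 0) ⊕ {C // C ∈ canonicalFormula f}) :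
    (incidenceGraph (canonicalFormula f)).Adj u v ↔ u.isLeft ≠ v.isLeft := by
  rcases u with (x | x) | C <;> rcases v with (y | y) | D <;> first | exact x.elim0 | exact y.elim0 |
    simp [incidenceGraph, canonicalFormula_hasVar]

/-! ### Widths of complete bipartite graphs -/

theorem cliquewidth_le_two_of_adj_iff {V : Type} [Finite V] {G : SimpleGraph V} (c : V → Bool)
    (hc : ∀ u v, G.Adj u v ↔ c u ≠ c v) : cliquewidth G ≤ 2 := by
  classical
  have := Fintype.ofFinite V
  by_cases hV : Nonempty V
  · obtain ⟨v⟩ := hV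
    apply Nat.sInf_le
    rcases (CWBuildable.edgeless (E := Unit) Finset.univ
      fun v => if c v then (0 : Fin 2) else 1).join () 0 1 (by simp) with ⟨h, -⟩ | h
    · exact absurd (h v) (by simp)
    · refine ⟨fun v => some (if c v then 0 else 1), fun v => Option.some_ne_none _, ?_⟩
      convert h using 2
      · simp
      ext u v
      have h1 := hc u v
      have h2 : u = v → c u = c v := congrArg c
      simp only [Finset.mem_univ, if_true, bot_sup_eq, SimpleGraph.fromRel_adj]
      cases hu : c u <;> cases hv : c v <;> simp_all <;> grind
  -- The graph without vertices does occur, for `n = 0`. It has no construction at all, and its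
  -- width is the default value `sInf ∅ = 0`.
  · have hempty : {k | HasCliquewidthLE (fun _ : Unit => G) k} = ∅ := by
      rw [Set.eq_empty_iff_forall_notMem]
      rintro k ⟨lab, -, h⟩
      apply hV
      generalize (fun _ : Unit => G) = G' at h
      induction h with
      | create v => exact ⟨v⟩
      | union _ _ _ ih => exact ih
      | join _ _ _ _ _ ih => exact ih
      | rename _ _ _ _ ih => exact ih
    rw [cliquewidth, hempty, Nat.sInf_empty]
    exact Nat.zero_le _

theorem hasTreewidthLE_of_card_le {V : Type} [Finite V] (G : SimpleGraph V) {w : ℕ}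
    (h : Nat.card V ≤ w + 1) : HasTreewidthLE G w := by
  have := Fintype.ofFinite V
  refine ⟨Unit, inferInstance, ⟨⊥, SimpleGraph.IsTree.of_subsingleton, fun _ => Finset.univ,
    by simp, by simp, fun v => ?_⟩, fun t => ?_⟩
  · have : Nonempty ↑{t : Unit | v ∈ (Finset.univ : Finset V)} := ⟨⟨(), by simp⟩⟩
    exact ⟨fun a b => by rw [Subsingleton.elim a b]⟩
  · simpa [Nat.card_eq_fintype_card] using h

/-- Vertices of equal color are twins, so at most two vertices remain after contraction. -/
theorem modularTreewidth_le_one_of_adj_iff {V : Type} [Finite V] {G : SimpleGraph V}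
    (c : V → Bool) (hc : ∀ u v, G.Adj u v ↔ c u ≠ c v) : modularTreewidth G ≤ 1 := by
  apply Nat.sInf_le
  have : Finite (Quotient (nbhdTypeSetoid G)) := Quotient.finite _
  apply hasTreewidthLE_of_card_le
  have hinj : Function.Injective fun q : Quotient (nbhdTypeSetoid G) => c q.out := by
    intro q q' h
    rw [← q.out_eq, ← q'.out_eq]
    refine Quotient.sound ((sameNbhdType_iff G _ _).2 fun w _ _ => ?_)
    rw [hc, hc]
    dsimp only at h
    rw [h]
  have := Nat.card_le_card_of_injective _ hinj
  simpa using this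

/-- Any branch decomposition works: if two matching edges start in the same color, the start of one
is adjacent to the end of the other, so there is at most one edge per color. -/
theorem mimWidth_le_two_of_adj_iff {V : Type} [Finite V] {G : SimpleGraph V} (c : V → Bool)
    (hc : ∀ u v, G.Adj u v ↔ c u ≠ c v) : mimWidth G ≤ 2 := by
  by_cases hV : Nonempty V
  · obtain ⟨w, T, hT, hT', -⟩ := exists_isMimDecomposition G
    refine Nat.sInf_le ⟨T, hT, hT', fun S _ M hM => ?_⟩
    have hinj : Set.InjOn (fun p : V × V => c p.1) M := by
      intro p hp q hq hpq
      by_contra hne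
      refine (hM.2 p hp q hq hne).2.2 ((hc _ _).2 ?_)
      have h := (hc _ _).1 (hM.1 q hq).2.2
      dsimp only at hpq
      rwa [hpq]
    have := Finset.card_le_card_of_injOn (t := Finset.univ) _ (fun _ _ => Finset.mem_univ _) hinj
    simpa using this
  · have hempty : {w | ∃ T, IsMimDecomposition G T w} = ∅ := by
      rw [Set.eq_empty_iff_forall_notMem]
      rintro k ⟨T, -⟩
      apply hV
      induction T with
      | leaf v => exact ⟨v⟩
      | node _ _ ih => exact ih
    rw [mimWidth, hempty, Nat.sInf_empty]
    exact Nat.zero_le _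

/-! ### Optimal encodings and the final bounds -/

theorem exists_isOptimalEncoding {μ : WidthMeasure} {n m : ℕ} {f : (Fin n → Bool) → Bool}
    {F : CNFFormula (Fin n ⊕ Fin m)} (hF : IsClausalEncoding F f) :
    ∃ (m' : ℕ) (F' : CNFFormula (Fin n ⊕ Fin m')), IsOptimalEncoding μ F' f := by
  classical
  have hex : ∃ w, ∃ (m' : ℕ) (F' : CNFFormula (Fin n ⊕ Fin m')),
      IsClausalEncoding F' f ∧ μ _ F' = w := ⟨_, m, F, hF, rfl⟩
  obtain ⟨m', F', hF', hw⟩ := Nat.find_spec hex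
  exact ⟨m', F', hF', fun m'' F'' hF'' => hw ▸ Nat.find_min' hex ⟨m'', F'', hF'', rfl⟩⟩

theorem exists_encoding_of_small_width {n k : ℕ} (hk : k ≤ n) (hs : 2 ≤ min k (n - k)) :
    ∃ (m : ℕ) (F : CNFFormula (Fin n ⊕ Fin m)),
      IsClausalEncoding F (cardinalityConstraint n k) ∧
      ∀ μ ∈ ({primalTreewidth, dualTreewidth, incidenceTreewidth, signedIncidenceCliquewidth} :
        Set WidthMeasure), μ _ F ≤ 51 * (Nat.log 2 (min k (n - k)) + 1) := by
  set s := min k (n - k) with hs'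
  set b := Nat.log 2 s + 1 with hb
  have hsb : s < 2 ^ b := Nat.lt_pow_succ_log_self (by norm_num) s
  have hex : ∃ σ, IsClausalEncoding (counterFormula n b s σ) (cardinalityConstraint n k) := by
    rcases le_total k (n - k) with h | h
    · refine ⟨true, counterFormula_isClausalEncoding hsb fun a => ?_⟩
      rw [hs', min_eq_left h]
      exact exists_indicator_of_cardinalityConstraint n k hk a
    · refine ⟨false, counterFormula_isClausalEncoding hsb fun a => ?_⟩
      rw [hs', min_eq_right h]
      exact exists_indicator_of_cardinalityConstraint' n k hk a
  obtain ⟨σ, hσ⟩ := hex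
  refine ⟨_, _, hσ, fun μ hμ => ?_⟩
  obtain ⟨sc, hl⟩ := counterFormula_isLayered n b s σ
  have : Nonempty (CounterVar n b) := ⟨Sum.inl ⟨0, by omega⟩⟩
  have h1 := hl.primalTreewidth_le
  have h2 := hl.dualTreewidth_le
  have h3 := hl.incidenceTreewidth_le
  have h4 := hl.signedIncidenceCliquewidth_le
  -- The largest of the four bounds is `2 * (20 * b + 5) + 1`, which is at most `51 * b` since `b ≥
  -- 1`.
  rcases hμ with rfl | rfl | rfl | rfl
  · exact h1.trans (by omega)
  · exact h2.trans (by omega)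
  · exact h3.trans (by omega)
  · exact h4.trans (by omega)

theorem le_sixteen_pow_of_isClausalEncoding {n m k : ℕ} {F : CNFFormula (Fin n ⊕ Fin m)}
    (hF : IsClausalEncoding F (cardinalityConstraint n k)) (hk : k ≤ n)
    (hs : 2 ≤ min k (n - k)) {μ : WidthMeasure}
    (hμ : μ ∈ ({primalTreewidth, dualTreewidth, incidenceTreewidth, signedIncidenceCliquewidth} :
        Set WidthMeasure)) : min k (n - k) ≤ 16 ^ μ _ F := by
  rcases hμ with rfl | rfl | rfl | rfl
  · exact le_sixteen_pow_primalTreewidth hF hk hs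
  · exact le_sixteen_pow_dualTreewidth hF hk hs
  · exact le_sixteen_pow_incidenceTreewidth hF hk hs
  · exact le_sixteen_pow_signedIncidenceCliquewidth hF hk hs

theorem mainTheorem11 :
    (∀ μ ∈ ({primalTreewidth, dualTreewidth, incidenceTreewidth, signedIncidenceCliquewidth} :
        Set WidthMeasure),
      ∃ c₁ c₂ : ℝ, 0 < c₁ ∧ 0 < c₂ ∧ ∀ n k : ℕ, k ≤ n → 2 ≤ min k (n - k) →
        (∃ (m : ℕ) (F : CNFFormula (Fin n ⊕ Fin m)),
          IsOptimalEncoding μ F (cardinalityConstraint n k)) ∧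
        ∀ (m : ℕ) (F : CNFFormula (Fin n ⊕ Fin m)),
          IsOptimalEncoding μ F (cardinalityConstraint n k) →
            c₁ * Real.logb 2 (min k (n - k) : ℕ) ≤ (μ _ F : ℝ) ∧
              (μ _ F : ℝ) ≤ c₂ * Real.logb 2 (min k (n - k) : ℕ)) ∧
    ∃ c : ℕ, ∀ n k : ℕ, ∃ (m : ℕ) (F : CNFFormula (Fin n ⊕ Fin m)),
      IsClausalEncoding F (cardinalityConstraint n k) ∧
        incidenceCliquewidth _ F ≤ c ∧ modularIncidenceTreewidth _ F ≤ c ∧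
          incidenceMimWidth _ F ≤ c := by
  -- The constant `1 / 4` comes from `16 = 2 ^ 4`. The constant `102` absorbs the `+ 1` in `51 *
  -- (log s + 1)`, as `log s ≥ 1`.
  refine ⟨fun μ hμ => ⟨1 / 4, 102, by norm_num, by norm_num, fun n k hk hs => ?_⟩, 2,
    fun n k => ⟨0, _, canonicalFormula_isClausalEncoding _, ?_, ?_, ?_⟩⟩
  · obtain ⟨m₀, F₀, hF₀, hw₀⟩ := exists_encoding_of_small_width hk hs
    refine ⟨exists_isOptimalEncoding hF₀, fun m F hF => ?_⟩
    have h1 := le_sixteen_pow_of_isClausalEncoding hF.1 hk hs hμ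
    have h2 := (hF.2 _ F₀ hF₀).trans (hw₀ μ hμ)
    set s := min k (n - k)
    have hs0 : (0 : ℝ) < s := by
      exact_mod_cast (by omega : 0 < s)
    constructor
    · have h3 : Real.logb 2 s ≤ Real.logb 2 ((2 : ℝ) ^ (4 * μ _ F)) := by
        refine Real.logb_le_logb_of_le (by norm_num) hs0 ?_
        rw [pow_mul]
        norm_num
        exact_mod_cast h1
      rw [Real.logb_pow, Real.logb_self_eq_one (by norm_num)] at h3
      push_cast at h3
      linarith
    · have h3 : (Nat.log 2 s : ℝ) ≤ Real.logb 2 s := by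
        exact_mod_cast Real.natLog_le_logb s 2
      have h4 : 1 ≤ Real.logb 2 s := by
        rw [Real.le_logb_iff_rpow_le (by norm_num) hs0, Real.rpow_one]
        exact_mod_cast hs
      have h5 : (μ _ F : ℝ) ≤ 51 * (Nat.log 2 s + 1) := by exact_mod_cast h2
      linarith
  · exact cliquewidth_le_two_of_adj_iff _ (canonicalFormula_incidenceGraph_adj _)
  · exact (modularTreewidth_le_one_of_adj_iff _ (canonicalFormula_incidenceGraph_adj _)).trans
      one_le_two
  · exact mimWidth_le_two_of_adj_iff _ (canonicalFormula_incidenceGraph_adj _)
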